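/- A digraph $\Gamma$ consists of a non-empty vertex set $V$ and an arc set $A\subseteq V\times V$ (loops allowed). It is regular if there is an integer $d\ge 0$ such that every vertex has exactly $d$ out-neighbours and exactly $d$ in-neighbours. Its automorphism group $\mathrm{Aut}(\Gamma)$ is the group of all permutations $\sigma$ of $V$ such that, for all $u,v\in V$, $(u^\sigma,v^\sigma)\in A$ if and only if $(u,v)\in A$. For a group $G$ and a positive integer $n$, an $n$-partite digraphical representation ($n$-PDR) of $G$ is a digraph $\Gamma$ such that * $\Gamma$ is regular; * $\mathrm{Aut}(\Gamma)\cong G$; * $\mathrm{Aut}(\Gamma)$ acts semiregularly on $V$, that is, all its point stabilisers are trivial; * $\mathrm{Aut}(\Gamma)$ has exactly $n$ orbits on $V$ and, for every orbit $X$, there is no arc of $\Gamma$ with both ends in $X$. **Theorem.** Let $G$ be a finite group and let $n$ be a positive integer. Then $G$ admits no $n$-partite digraphical representation if and only if one of the following holds: 1. $n=1$ and $|G|\ge 3$; 2. $n=2$ and $G$ is isomorphic to one of $\mathbb{Z}_1$, $\mathbb{Z}_2$, $\mathbb{Z}_3$, $\mathbb{Z}_2\times\mathbb{Z}_2$, $\mathbb{Z}_2\times\mathbb{Z}_2\times\mathbb{Z}_2$;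 3. $3\le n\le 5$ and $G\cong\mathbb{Z}_1$. Here $\mathbb{Z}_k$ denotes the cyclic group of order $k$. -/

import Mathlib

universe u v

namespace Digraph

/-- The automorphism group of a digraph, as a permutation group on its vertex set. -/
def autGroup {V : Type v} (Γ : Digraph V) : Subgroup (Equiv.Perm V) where
  carrier := {σ | ∀ x y : V, Γ.Adj (σ x) (σ y) ↔ Γ.Adj x y}
  one_mem' := fun _ _ => Iff.rfl
  mul_mem' := fun {σ τ} hσ hτ x y => (hσ (τ x) (τ y)).trans (hτ x y)
  inv_mem' := fun {σ} hσ x y => by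
    have h := hσ (σ⁻¹ x) (σ⁻¹ y)
    simpa using h.symm

/-- A digraph is regular if, for some natural number `d`, every vertex has exactly `d`
out-neighbours and exactly `d` in-neighbours. -/
def IsRegular {V : Type v} (Γ : Digraph V) : Prop :=
  ∃ d : ℕ, ∀ x : V, {y : V | Γ.Adj x y}.encard = d ∧ {y : V | Γ.Adj y x}.encard = d

end Digraph

/-- A permutation group is semiregular if all its point stabilisers are trivial. -/
def Equiv.Perm.IsSemiregularSubgroup {V : Type v} (A : Subgroup (Equiv.Perm V)) : Prop :=
  ∀ x : V, MulAction.stabilizer A x = ⊥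

/-- `Γ` is an `n`-partite digraphical representation of the group `G`. -/
structure Digraph.IsPartiteRepresentation {V : Type v} (Γ : Digraph V)
    (G : Type u) [Group G] (n : ℕ) : Prop where
  regular : Γ.IsRegular
  aut_iso : Nonempty (Γ.autGroup ≃* G)
  semiregular : Equiv.Perm.IsSemiregularSubgroup Γ.autGroup
  card_orbits : ENat.card (MulAction.orbitRel.Quotient Γ.autGroup V) = n
  /-- the sub-digraph induced on each orbit has no arcs (in particular, no loops) -/
  orbit_empty : ∀ z : V, ∀ x ∈ MulAction.orbit Γ.autGroup z,
    ∀ y ∈ MulAction.orbit Γ.autGroup z, ¬ Γ.Adj x y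

/-- `G` admits an `n`-partite digraphical representation; the vertex set is a non-empty type
in an arbitrary universe `v`. -/
def AdmitsPartiteRepresentation (G : Type u) [Group G] (n : ℕ) : Prop :=
  ∃ (V : Type v) (_ : Nonempty V) (Γ : Digraph V), Γ.IsPartiteRepresentation G n

/-!
A partite representation of `G` is a multi-Cayley digraph on `G × I`, because a semiregular group
acts regularly on each of its orbits; so everything is a question about connection sets.

For `n ≥ 3` and `G` nontrivial, take an irredundant generating set `x 0, …, x (m - 1)` and a cyclic
arrangement of the orbits in which the bidirected arcs form the paths `{g} × I`. Automorphisms then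
permute these paths. The remaining arcs between consecutive orbits use the generators, the
generators with `x 0` replaced by `1`, and the quotients of consecutive generators, so that an
automorphism fixing the path of `1` fixes `x 0` and then the other generators one by one.

For `n = 2` the same idea uses arcs with labels `{1, x 0, …, x (m - 1)}` in one direction and `1`,
the quotients of consecutive generators and one more element `y` in the other: `y = x 0` if
`x 0 ^ 2 ≠ 1`, and `y = x 0 * (x 2 * x 3)` in an elementary abelian 2-group of rank at least four.
In the exceptional groups, any two subsets of the same size are both preserved or exchanged by
a nontrivial affine map, which yields an automorphism that is not a translation.

For the trivial group one needs loopless regular digraphs without symmetry. A regular digraph is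
a union of permutations, and passing to complements makes its valency so small on at most five
vertices that there is always a symmetry; explicit examples exist on six or more vertices.
-/

variable {G I V W : Type*} [Group G]

section MultiCayley

/-- The multi-Cayley digraph of `G` with connection sets `S i j`, on the vertex set `G × I`. Up to
isomorphism these are the digraphs on which `G` acts semiregularly, with orbits indexed by `I`. -/
def multiCayley (S : I → I → Set G) : Digraph (G × I) where
  Adj x y := x.1⁻¹ * y.1 ∈ S x.2 y.2

theorem multiCayley_adj {S : I → I → Set G} {x y : G × I} :
    (multiCayley S).Adj x y ↔ x.1⁻¹ * y.1 ∈ S x.2 y.2 := Iff.rfl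

/-- The connection sets of the `I`-partite digraphical representations of `G`. -/
structure IsPartiteConnection (S : I → I → Set G) : Prop where
  regular : (multiCayley S).IsRegular
  diag_eq_empty : ∀ i, S i i = ∅
  rigid : ∀ σ ∈ (multiCayley S).autGroup, ∃ t : G, ∀ x, σ x = (t * x.1, x.2)

theorem isRegular_iff_of_equiv {Γ : Digraph V} {Δ : Digraph W} (e : V ≃ W)
    (he : ∀ x y, Δ.Adj (e x) (e y) ↔ Γ.Adj x y) : Γ.IsRegular ↔ Δ.IsRegular := by
  refine exists_congr fun d => Iff.trans (forall_congr' fun x => ?_) e.surjective.forall.symm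
  rw [← Set.encard_preimage_of_bijective e.bijective {y | Δ.Adj (e x) y},
    ← Set.encard_preimage_of_bijective e.bijective {y | Δ.Adj y (e x)}]
  simp only [Set.preimage_ofPred_eq, he]

theorem permCongr_mem_autGroup_iff {Γ : Digraph V} {Δ : Digraph W} (e : V ≃ W)
    (he : ∀ x y, Δ.Adj (e x) (e y) ↔ Γ.Adj x y) {σ : Equiv.Perm V} :
    e.permCongr σ ∈ Δ.autGroup ↔ σ ∈ Γ.autGroup :=
  e.surjective.forall₂.trans <| forall₂_congr fun x y => by simp [he]

theorem encard_out_multiCayley [Fintype I] (S : I → I → Set G) (x : G × I) :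
    {y | (multiCayley S).Adj x y}.encard = ∑ j, (S x.2 j).encard := by
  have hunion : {y | (multiCayley S).Adj x y} = ⋃ j, (fun c => (x.1 * c, j)) '' S x.2 j := by
    ext ⟨h, j⟩
    simp [multiCayley_adj, ← eq_inv_mul_iff_mul_eq]
  rw [hunion, Set.encard_iUnion_of_finite, finsum_eq_sum_of_fintype]
  · refine Finset.sum_congr rfl fun j _ => Function.Injective.encard_image ?_ _
    exact fun a b hab => mul_left_cancel (congrArg Prod.fst hab)
  · intro i j hij
    simp +contextual [Function.onFun, Set.disjoint_left, hij.symm]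

theorem encard_in_multiCayley [Fintype I] (S : I → I → Set G) (x : G × I) :
    {y | (multiCayley S).Adj y x}.encard = ∑ j, (S j x.2).encard := by
  have hunion : {y | (multiCayley S).Adj y x} = ⋃ j, (fun c => (x.1 * c⁻¹, j)) '' S j x.2 := by
    ext ⟨h, j⟩
    simp only [multiCayley_adj, Set.mem_ofPred_eq, Set.mem_iUnion, Set.mem_image, Prod.mk.injEq]
    constructor
    · exact fun hS => ⟨j, _, hS, by simp⟩
    · rintro ⟨_, c, hc, rfl, rfl⟩
      simpa using hc
  rw [hunion, Set.encard_iUnion_of_finite, finsum_eq_sum_of_fintype]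
  · refine Finset.sum_congr rfl fun j _ => Function.Injective.encard_image ?_ _
    exact fun a b hab => inv_injective (mul_left_cancel (congrArg Prod.fst hab))
  · intro i j hij
    simp +contextual [Function.onFun, Set.disjoint_left, hij.symm]

theorem isRegular_multiCayley_iff [Fintype I] {S : I → I → Set G} :
    (multiCayley S).IsRegular ↔
      ∃ d : ℕ, ∀ i, ∑ j, (S i j).encard = d ∧ ∑ j, (S j i).encard = d := by
  simp only [Digraph.IsRegular, encard_out_multiCayley, encard_in_multiCayley, Prod.forall,
    forall_const]

/-- Left translation of `G × I` by elements of `G`, transported to `V` along `e`. -/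
def translationHom (e : V ≃ G × I) : G →* Equiv.Perm V where
  toFun t := e.symm.permCongr ((Equiv.mulLeft t).prodCongr (Equiv.refl I))
  map_one' := by ext x; simp
  map_mul' a b := by ext x; simp [Prod.map]

theorem translationHom_apply (e : V ≃ G × I) (t : G) (x : V) :
    translationHom e t x = e.symm (t * (e x).1, (e x).2) := rfl

theorem translationHom_injective [Nonempty I] (e : V ≃ G × I) :
    Function.Injective (translationHom e) := by
  intro s t hst
  obtain ⟨i⟩ := ‹Nonempty I›
  simpa [translationHom_apply] using DFunLike.congr_fun hst (e.symm (1, i))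

theorem translationHom_apply_eq_self (e : V ≃ G × I) {t : G} {x : V} :
    translationHom e t x = x ↔ t = 1 := by
  simp [translationHom_apply, Equiv.symm_apply_eq, Prod.ext_iff]

variable {S : I → I → Set G} {Γ : Digraph V}

theorem IsPartiteConnection.range_translationHom (hS : IsPartiteConnection S) (e : V ≃ G × I)
    (he : ∀ x y, (multiCayley S).Adj (e x) (e y) ↔ Γ.Adj x y) :
    (translationHom e).range = Γ.autGroup := by
  ext σ
  constructor
  · rintro ⟨t, rfl⟩ x y
    simp [← he, translationHom_apply, multiCayley_adj, mul_assoc]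
  · intro hσ
    obtain ⟨t, ht⟩ := hS.rigid _ ((permCongr_mem_autGroup_iff e he).2 hσ)
    refine ⟨t, Equiv.ext fun x => e.symm_apply_eq.2 (.symm ?_)⟩
    simpa [Prod.map] using ht (e x)

theorem IsPartiteConnection.mem_orbit_iff (hS : IsPartiteConnection S) (e : V ≃ G × I)
    (he : ∀ x y, (multiCayley S).Adj (e x) (e y) ↔ Γ.Adj x y) {x y : V} :
    x ∈ MulAction.orbit Γ.autGroup y ↔ (e x).2 = (e y).2 := by
  rw [← hS.range_translationHom e he]
  constructor
  · rintro ⟨⟨_, t, rfl⟩, rfl⟩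
    simp [Subgroup.smul_def, translationHom_apply]
  · intro hxy
    refine ⟨⟨_, (e x).1 * (e y).1⁻¹, rfl⟩, ?_⟩
    change translationHom e _ y = x
    rw [translationHom_apply, inv_mul_cancel_right, ← hxy, e.symm_apply_apply]

theorem IsPartiteConnection.isPartiteRepresentation [Nonempty I] [Finite I]
    (hS : IsPartiteConnection S) (e : V ≃ G × I)
    (he : ∀ x y, (multiCayley S).Adj (e x) (e y) ↔ Γ.Adj x y) :
    Γ.IsPartiteRepresentation G (Nat.card I) where
  regular := (isRegular_iff_of_equiv e he).2 hS.regular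
  aut_iso := ⟨(MulEquiv.subgroupCongr (hS.range_translationHom e he).symm).trans
    (MonoidHom.ofInjective (translationHom_injective e)).symm⟩
  semiregular x := by
    rw [eq_bot_iff, ← hS.range_translationHom e he]
    rintro ⟨_, t, rfl⟩ hx
    obtain rfl : t = 1 := (translationHom_apply_eq_self e).1 hx
    simp
  card_orbits := by
    let f : MulAction.orbitRel.Quotient Γ.autGroup V → I :=
      Quotient.lift (fun x => (e x).2) fun x y => (hS.mem_orbit_iff e he).1
    have hf : Function.Bijective f := by
      refine ⟨?_, fun i => ⟨Quotient.mk _ (e.symm (1, i)), ?_⟩⟩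
      · rintro ⟨x⟩ ⟨y⟩ hxy
        exact Quotient.sound ((hS.mem_orbit_iff e he).2 hxy)
      · exact congrArg Prod.snd (e.apply_symm_apply (1, i))
    rw [ENat.card_congr (Equiv.ofBijective f hf), ENat.card_eq_coe_natCard]
  orbit_empty z x hx y hy := by
    have hxy : (e x).2 = (e y).2 :=
      ((hS.mem_orbit_iff e he).1 hx).trans ((hS.mem_orbit_iff e he).1 hy).symm
    rw [← he, multiCayley_adj, hxy, hS.diag_eq_empty]
    exact Set.notMem_empty _

theorem IsPartiteConnection.admits {G : Type u} [Group G] [Finite G] [Finite I] [Nonempty I]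
    {S : I → I → Set G} (hS : IsPartiteConnection S) :
    AdmitsPartiteRepresentation.{u, v} G (Nat.card I) := by
  obtain ⟨N, ⟨e⟩⟩ := Finite.exists_equiv_fin (G × I)
  let f : ULift.{v} (Fin N) ≃ G × I := Equiv.ulift.trans e.symm
  let Γ : Digraph (ULift.{v} (Fin N)) := ⟨fun x y => (multiCayley S).Adj (f x) (f y)⟩
  exact ⟨_, f.nonempty, Γ, hS.isPartiteRepresentation f fun _ _ => Iff.rfl⟩

/-- Representatives of the orbits of a semiregular group give coordinates in `G × I`. -/
theorem exists_coordinates {A : Subgroup (Equiv.Perm V)} (φ : A ≃* G)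
    (hA : Equiv.Perm.IsSemiregularSubgroup A) (ε : I ≃ MulAction.orbitRel.Quotient A V) :
    ∃ e : G × I ≃ V, (∀ t g i, e (t * g, i) = φ.symm t • e (g, i)) ∧
      ∀ x y, x.2 = y.2 → e x ∈ MulAction.orbit A (e y) := by
  let f : G × I → V := fun x => φ.symm x.1 • (ε x.2).out
  have hf_orbit : ∀ x, Quotient.mk (MulAction.orbitRel A V) (f x) = ε x.2 := fun x => by
    simp [f]
  have hf : Function.Bijective f := by
    constructor
    · rintro ⟨g, i⟩ ⟨h, j⟩ hgh
      obtain rfl : i = j := ε.injective <| by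
        simpa only [hf_orbit] using congrArg (Quotient.mk (MulAction.orbitRel A V)) hgh
      have hstab : (φ.symm h)⁻¹ * φ.symm g ∈ MulAction.stabilizer A (ε i).out := by
        rw [MulAction.mem_stabilizer_iff, mul_smul, inv_smul_eq_iff]
        exact hgh
      rw [hA, Subgroup.mem_bot, inv_mul_eq_one] at hstab
      rw [φ.symm.injective hstab]
    · intro v
      obtain ⟨a, ha⟩ : v ∈ MulAction.orbit A (Quotient.mk (MulAction.orbitRel A V) v).out :=
        MulAction.orbitRel_apply.1 (Quotient.exact (Quotient.out_eq _).symm)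
      exact ⟨(φ a, ε.symm (Quotient.mk _ v)), by simpa [f] using ha⟩
  refine ⟨Equiv.ofBijective f hf, fun t g i => by simp [f, mul_smul], fun x y hxy => ?_⟩
  exact MulAction.orbitRel_apply.1 <| Quotient.exact <| by simp [hf_orbit, hxy]

theorem exists_isPartiteConnection [Finite I] (h : Γ.IsPartiteRepresentation G (Nat.card I)) :
    ∃ S : I → I → Set G, IsPartiteConnection S := by
  obtain ⟨φ⟩ := h.aut_iso
  have hcard := h.card_orbits
  have : Finite (MulAction.orbitRel.Quotient Γ.autGroup V) :=
    ENat.card_lt_top.1 (by simp [hcard])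
  rw [ENat.card_eq_coe_natCard, Nat.cast_inj, eq_comm, Finite.card_eq] at hcard
  obtain ⟨ε⟩ := hcard
  obtain ⟨e, he_mul, he_orbit⟩ := exists_coordinates φ h.semiregular ε
  let S : I → I → Set G := fun i j => {g | Γ.Adj (e (1, i)) (e (g, j))}
  have hadj : ∀ x y, Γ.Adj (e x) (e y) ↔ (multiCayley S).Adj x y := by
    rintro ⟨g, i⟩ ⟨h, j⟩
    have he_apply : ∀ c k, e (g * c, k) = (φ.symm g : Equiv.Perm V) (e (c, k)) := he_mul g
    simpa [multiCayley_adj, S, ← he_apply] using (φ.symm g).2 (e (1, i)) (e (g⁻¹ * h, j))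
  refine ⟨S, (isRegular_iff_of_equiv e hadj).2 h.regular, fun i => ?_, fun σ hσ => ?_⟩
  · ext g
    simpa [S] using h.orbit_empty _ _ (MulAction.mem_orbit_self _) _ (he_orbit (g, i) (1, i) rfl)
  · let τ : Γ.autGroup := ⟨e.permCongr σ, (permCongr_mem_autGroup_iff e hadj).2 hσ⟩
    refine ⟨φ τ, fun x => e.injective ?_⟩
    rw [he_mul, φ.symm_apply_apply]
    simp [τ, Subgroup.smul_def]

/-- A partite representation is a multi-Cayley digraph, because its automorphism group acts
regularly on each orbit. -/
theorem admitsPartiteRepresentation_iff {G : Type u} [Group G] [Finite G] [Finite I] [Nonempty I] :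
    AdmitsPartiteRepresentation.{u, v} G (Nat.card I) ↔
      ∃ S : I → I → Set G, IsPartiteConnection S :=
  ⟨fun ⟨_, _, _, h⟩ => exists_isPartiteConnection h, fun ⟨_, hS⟩ => hS.admits⟩

end MultiCayley

section Rigidity

theorem apply_eq_apply_of_injective {f e : V → W} (hf : Function.Injective f) {a : V} {N : Set V}
    (ha : f a ∈ e '' N) (hN : ∀ b ∈ N, b ≠ a → f b = e b) : f a = e a := by
  obtain ⟨b, hb, hba⟩ := ha
  obtain rfl | hne := eq_or_ne b a
  · exact hba.symm
  · exact absurd (hf ((hN b hb hne).trans hba)) hne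

theorem apply_eq_self_of_injective {τ : V → V} (hτ : Function.Injective τ) {a : V} {N : Set V}
    (ha : τ a ∈ N) (hN : ∀ b ∈ N, b ≠ a → τ b = b) : τ a = a :=
  apply_eq_apply_of_injective (e := id) hτ (by simpa using ha) hN

/-- For all `i` and `j`, `τ` embeds the Cayley digraph of `G` with connection set `S i j` into the
one with connection set `S' i j`. -/
structure IsCayleyEmbedding (S S' : I → I → Set G) (τ : G → G) : Prop where
  injective : Function.Injective τ
  mem_iff : ∀ i j g h, (τ g)⁻¹ * τ h ∈ S' i j ↔ g⁻¹ * h ∈ S i j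

namespace IsCayleyEmbedding

variable {S S' : I → I → Set G} {τ : G → G}

theorem apply_mem_iff (hτ : IsCayleyEmbedding S S' τ) (h1 : τ 1 = 1) {i j : I} {g : G} :
    τ g ∈ S' i j ↔ g ∈ S i j := by
  simpa [h1] using hτ.mem_iff i j 1 g

theorem mul_comp_mul (hτ : IsCayleyEmbedding S S' τ) (s t : G) :
    IsCayleyEmbedding S S' fun g => s * τ (t * g) where
  injective := (mul_right_injective s).comp (hτ.injective.comp (mul_right_injective t))
  mem_iff i j g h := by simpa [mul_assoc] using hτ.mem_iff i j (t * g) (t * h)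

theorem eq_mul {R : Set G} (hR : Subgroup.closure R = ⊤)
    (hfix : ∀ τ, IsCayleyEmbedding S S τ → τ 1 = 1 → ∀ r ∈ R, τ r = r)
    (hτ : IsCayleyEmbedding S S τ) (g : G) : τ g = τ 1 * g := by
  have hmul_gen : ∀ h, ∀ r ∈ R, τ (h * r) = τ h * r := fun h r hr => by
    simpa [inv_mul_eq_iff_eq_mul] using hfix _ (hτ.mul_comp_mul (τ h)⁻¹ h) (by simp) r hr
  have hmul : ∀ c ∈ Subgroup.closure R, ∀ h, τ (h * c) = τ h * c := by
    intro c hc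
    induction hc using Subgroup.closure_induction with
    | mem r hr => exact fun h => hmul_gen h r hr
    | one => simp
    | mul a b _ _ ha hb => exact fun h => by rw [← mul_assoc, hb, ha, mul_assoc]
    | inv a _ ha => exact fun h => by simpa [eq_mul_inv_iff_mul_eq] using (ha (h * a⁻¹)).symm
  simpa using hmul g (hR ▸ Subgroup.mem_top g) 1

end IsCayleyEmbedding

theorem IsPartiteConnection.of_fixes_generators [Nonempty I] {S : I → I → Set G}
    (hreg : (multiCayley S).IsRegular) (hdiag : ∀ i, S i i = ∅)
    (hfibre : ∀ σ ∈ (multiCayley S).autGroup, ∃ τ : G → G, ∀ g i, σ (g, i) = (τ g, i))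
    {R : Set G} (hR : Subgroup.closure R = ⊤)
    (hfix : ∀ τ, IsCayleyEmbedding S S τ → τ 1 = 1 → ∀ r ∈ R, τ r = r) : IsPartiteConnection S := by
  refine ⟨hreg, hdiag, fun σ hσ => ?_⟩
  obtain ⟨τ, hτ⟩ := hfibre σ hσ
  have hcayley : IsCayleyEmbedding S S τ := by
    refine ⟨fun g h hgh => ?_, fun i j g h => ?_⟩
    · obtain ⟨i⟩ := ‹Nonempty I›
      exact congrArg Prod.fst (σ.injective (a₁ := (g, i)) (a₂ := (h, i)) (by rw [hτ, hτ, hgh]))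
    · simpa only [hτ, multiCayley_adj] using hσ (g, i) (h, j)
  exact ⟨τ 1, fun ⟨g, i⟩ => by rw [hτ, hcayley.eq_mul hR hfix]⟩

end Rigidity

section Generators

/-- The subgroup generated by all `x i`, `i < m`, except `x k`. -/
def othersClosure (x : ℕ → G) (m k : ℕ) : Subgroup G :=
  Subgroup.closure (x '' (Set.Iio m \ {k}))

/-- `x 0, …, x (m - 1)` generate `G`, and none of them lies in the subgroup generated by the
others. The remaining values of `x` are arbitrary. -/
structure IrredundantGenerators (x : ℕ → G) (m : ℕ) : Prop where
  closure_eq : Subgroup.closure (x '' Set.Iio m) = ⊤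
  notMem : ∀ k < m, x k ∉ othersClosure x m k

/-- The quotients of consecutive terms of `x 0, …, x (m - 1)`. -/
def steps (x : ℕ → G) (m : ℕ) : Set G :=
  (fun i => (x i)⁻¹ * x (i + 1)) '' Set.Iio (m - 1)

variable {x : ℕ → G} {m : ℕ}

theorem mem_othersClosure (x : ℕ → G) {i k : ℕ} (hi : i < m) (hik : i ≠ k) :
    x i ∈ othersClosure x m k :=
  Subgroup.subset_closure ⟨i, ⟨hi, hik⟩, rfl⟩

theorem mem_steps {g : G} : g ∈ steps x m ↔ ∃ i, i + 1 < m ∧ (x i)⁻¹ * x (i + 1) = g := by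
  simp only [steps, Set.mem_image, Set.mem_Iio, Nat.lt_sub_iff_add_lt]

/-- If the arcs of `Cay(G, Q)` among the generators form a path, an endomorphism of it that
permutes the generators and fixes the first one fixes them one after the other. -/
theorem fixes_of_path {Q : Set G} (hQ : steps x m ⊆ Q)
    (hpath : ∀ a < m, ∀ b < m, (x a)⁻¹ * x b ∈ Q → a = b ∨ a = b + 1 ∨ b = a + 1) {τ : G → G}
    (hinj : Function.Injective τ) (harc : ∀ g h : G, g⁻¹ * h ∈ Q → (τ g)⁻¹ * τ h ∈ Q)
    (hmaps : ∀ i < m, τ (x i) ∈ x '' Set.Iio m) (h0 : τ (x 0) = x 0) : ∀ i < m, τ (x i) = x i := by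
  intro i
  induction i using Nat.strong_induction_on with
  | _ i ih =>
    intro hi
    obtain _ | k := i
    · exact h0
    have hk : τ (x k) = x k := ih k (by omega) (by omega)
    refine apply_eq_self_of_injective hinj (N := x '' {j | j < m ∧ (x k)⁻¹ * x j ∈ Q}) ?_ ?_
    · obtain ⟨j, hj, hτ⟩ := hmaps (k + 1) hi
      refine ⟨j, ⟨hj, ?_⟩, hτ⟩
      rw [hτ, ← hk]
      exact harc _ _ (hQ (mem_steps.2 ⟨k, hi, rfl⟩))
    · rintro _ ⟨j, ⟨hj, hjk⟩, rfl⟩ hne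
      have hj_ne : j ≠ k + 1 := fun h => hne (h ▸ rfl)
      have := hpath k (by omega) j hj hjk
      exact ih j (by omega) hj

theorem irredundantGenerators_rank [Group.FG G]
    (hx : Subgroup.closure (x '' Set.Iio (Group.rank G)) = ⊤) :
    IrredundantGenerators x (Group.rank G) := by
  classical
  refine ⟨hx, fun k hk hmem => ?_⟩
  let T := ((Finset.range (Group.rank G)).erase k).image x
  have hT : Subgroup.closure (T : Set G) = ⊤ := by
    have hcoe : (T : Set G) = x '' (Set.Iio (Group.rank G) \ {k}) := by simp [T]
    rw [eq_top_iff, ← hx, Subgroup.closure_le, hcoe]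
    rintro _ ⟨i, hi, rfl⟩
    by_cases hik : i = k
    · exact hik ▸ hmem
    · exact mem_othersClosure x hi hik
  have hcard : T.card ≤ Group.rank G - 1 := by
    simpa [T, hk] using Finset.card_image_le (s := (Finset.range (Group.rank G)).erase k) (f := x)
  have hrank := Group.rank_le hT
  omega

theorem exists_enumeration {S : Finset V} {s : V} (hs : s ∈ S) :
    ∃ x : ℕ → V, x 0 = s ∧ x '' Set.Iio S.card = S := by
  classical
  let l := s :: (S.erase s).toList
  have hl : l.length = S.card := by
    simp [l, Finset.card_erase_add_one hs]
  refine ⟨fun i => l.getD i s, rfl, Set.ext fun a => ?_⟩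
  have hal : a ∈ S ↔ a ∈ l := by
    by_cases ha : a = s <;> simp [l, ha, hs]
  rw [Finset.mem_coe, hal, List.mem_iff_getElem, hl.symm]
  refine exists_congr fun i => ⟨?_, ?_⟩
  · rintro ⟨hi, rfl⟩
    exact ⟨hi, (List.getD_eq_getElem _ _ hi).symm⟩
  · rintro ⟨hi, rfl⟩
    exact ⟨hi, List.getD_eq_getElem _ _ hi⟩

theorem exists_irredundantGenerators_of_mem [Group.FG G] {S : Finset G}
    (hcard : S.card = Group.rank G) (hS : Subgroup.closure (S : Set G) = ⊤) {s : G} (hs : s ∈ S) :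
    ∃ x : ℕ → G, IrredundantGenerators x (Group.rank G) ∧ x 0 = s := by
  obtain ⟨x, hx0, hxS⟩ := exists_enumeration hs
  exact ⟨x, irredundantGenerators_rank (by rw [← hcard, hxS, hS]), hx0⟩

theorem exists_irredundantGenerators (G : Type*) [Group G] [Group.FG G] :
    ∃ x : ℕ → G, IrredundantGenerators x (Group.rank G) := by
  obtain _ | _ := subsingleton_or_nontrivial G
  · exact ⟨1, irredundantGenerators_rank (Subsingleton.elim _ _)⟩
  obtain ⟨S, hcard, hS⟩ := Group.rank_spec G
  obtain ⟨s, hs⟩ : S.Nonempty := Finset.card_pos.1 (hcard ▸ Group.rank_pos G)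
  obtain ⟨x, hx, -⟩ := exists_irredundantGenerators_of_mem hcard hS hs
  exact ⟨x, hx⟩

theorem sq_eq_one_of_generators {S : Set G} (hS : Subgroup.closure S = ⊤)
    (hsq : ∀ s ∈ S, s ^ 2 = 1) (hmul : ∀ a ∈ S, ∀ b ∈ S, (a * b) ^ 2 = 1) (g : G) : g ^ 2 = 1 := by
  have hcomm : ∀ a ∈ S, ∀ b ∈ S, a * b = b * a := by
    intro a ha b hb
    have hinv : ∀ c : G, c ^ 2 = 1 → c⁻¹ = c := fun c hc =>
      inv_eq_of_mul_eq_one_left (by rwa [← pow_two])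
    rw [← hinv _ (hmul a ha b hb), mul_inv_rev, hinv a (hsq a ha), hinv b (hsq b hb)]
  have hcommG : IsMulCommutative (Subgroup.closure S) := Subgroup.isMulCommutative_closure hcomm
  have hg : g ∈ Subgroup.closure S := hS ▸ Subgroup.mem_top g
  induction hg using Subgroup.closure_induction with
  | mem s hs => exact hsq s hs
  | one => exact one_pow 2
  | mul a b ha hb iha ihb =>
    have hab : Commute a b := congrArg Subtype.val (hcommG.is_comm.comm ⟨a, ha⟩ ⟨b, hb⟩)
    rw [hab.mul_pow, iha, ihb, one_mul]
  | inv a _ iha => rw [inv_pow, iha, inv_one]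

theorem exists_generators_sq_ne_one [Group.FG G] (hG : ∃ g : G, g ^ 2 ≠ 1) :
    ∃ S : Finset G, S.card = Group.rank G ∧ Subgroup.closure (S : Set G) = ⊤ ∧
      ∃ s ∈ S, s ^ 2 ≠ 1 := by
  classical
  obtain ⟨S, hcard, hS⟩ := Group.rank_spec G
  by_contra! hno
  have hsq := hno S hcard hS
  obtain ⟨g, hg⟩ := hG
  refine hg (sq_eq_one_of_generators hS hsq (fun a ha b hb => ?_) g)
  obtain rfl | hab := eq_or_ne a b
  · rw [← pow_two, hsq a ha, one_pow]
  let S' := insert (a * b) (S.erase a)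
  have hb' : b ∈ Subgroup.closure (S' : Set G) :=
    Subgroup.subset_closure (by simp [S', hab.symm, Finset.mem_coe.1 hb])
  have hab' : a * b ∈ Subgroup.closure (S' : Set G) := Subgroup.subset_closure (by simp [S'])
  have hS' : Subgroup.closure (S' : Set G) = ⊤ := by
    rw [eq_top_iff, ← hS, Subgroup.closure_le]
    intro s hs
    by_cases hsa : s = a
    · simpa [hsa] using mul_mem hab' (inv_mem hb')
    · exact Subgroup.subset_closure (by simp [S', hsa, Finset.mem_coe.1 hs])
  refine hno S' (le_antisymm ?_ (Group.rank_le hS')) hS' _ (Finset.mem_insert_self _ _)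
  exact (Finset.card_insert_le _ _).trans (by rw [Finset.card_erase_add_one ha, hcard])

theorem exists_irredundantGenerators_sq_ne_one [Group.FG G] (hG : ∃ g : G, g ^ 2 ≠ 1) :
    ∃ x : ℕ → G, IrredundantGenerators x (Group.rank G) ∧ x 0 ^ 2 ≠ 1 := by
  obtain ⟨S, hcard, hS, s, hs, hs2⟩ := exists_generators_sq_ne_one hG
  obtain ⟨x, hx, rfl⟩ := exists_irredundantGenerators_of_mem hcard hS hs
  exact ⟨x, hx, hs2⟩

namespace IrredundantGenerators

theorem ne_one (hx : IrredundantGenerators x m) {i : ℕ} (hi : i < m) : x i ≠ 1 := fun h =>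
  hx.notMem i hi (h ▸ one_mem _)

theorem injOn (hx : IrredundantGenerators x m) : Set.InjOn x (Set.Iio m) := by
  intro i hi j hj h
  by_contra hne
  exact hx.notMem i hi (h ▸ mem_othersClosure x hj (Ne.symm hne))

theorem mem_of_quotient_mem_closure (hx : IrredundantGenerators x m) {a b : ℕ} (ha : a < m)
    (hb : b < m) (hab : a ≠ b) {J : Set ℕ} (hJ : J ⊆ Set.Iio m)
    (h : (x a)⁻¹ * x b ∈ Subgroup.closure (x '' J)) : a ∈ J ∧ b ∈ J := by
  have hle : ∀ k ∉ J, Subgroup.closure (x '' J) ≤ othersClosure x m k := fun k hk =>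
    Subgroup.closure_mono (Set.image_mono fun j hj => ⟨hJ hj, fun hjk => hk (hjk ▸ hj)⟩)
  constructor
  · by_contra haJ
    refine hx.notMem a ha (inv_mem_iff.1 ?_)
    exact (Subgroup.mul_mem_cancel_right _ (mem_othersClosure x hb hab.symm)).1 (hle a haJ h)
  · by_contra hbJ
    refine hx.notMem b hb ?_
    exact (Subgroup.mul_mem_cancel_left _ (inv_mem (mem_othersClosure x ha hab))).1 (hle b hbJ h)

theorem eq_or_eq_of_quotient_mem_closure (hx : IrredundantGenerators x m) {a b c d : ℕ}
    (ha : a < m) (hb : b < m) (hc : c < m) (hd : d < m) (hab : a ≠ b)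
    (h : (x a)⁻¹ * x b ∈ Subgroup.closure {x c, x d}) : (a = c ∧ b = d) ∨ (a = d ∧ b = c) := by
  rw [← Set.image_pair] at h
  have := hx.mem_of_quotient_mem_closure ha hb hab (Set.pair_subset hc hd) h
  simp only [Set.mem_insert_iff, Set.mem_singleton_iff] at this
  omega

theorem quotient_ne (hx : IrredundantGenerators x m) {a b c : ℕ} (ha : a < m) (hb : b < m)
    (hc : c < m) : (x a)⁻¹ * x b ≠ x c := by
  intro h
  obtain rfl | hab := eq_or_ne a b
  · exact hx.ne_one hc (by rw [← h, inv_mul_cancel])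
  · have hmem : (x a)⁻¹ * x b ∈ Subgroup.closure {x c, x c} :=
      h ▸ Subgroup.subset_closure (by simp)
    have := hx.eq_or_eq_of_quotient_mem_closure ha hb hc hc hab hmem
    omega

theorem quotient_eq_quotient (hx : IrredundantGenerators x m) {a b c d : ℕ} (ha : a < m)
    (hb : b < m) (hc : c < m) (hd : d < m) (hab : a ≠ b) (h : (x a)⁻¹ * x b = (x c)⁻¹ * x d) :
    (a = c ∧ b = d) ∨ (a = d ∧ b = c) :=
  hx.eq_or_eq_of_quotient_mem_closure ha hb hc hd hab <| h ▸
    mul_mem (inv_mem (Subgroup.subset_closure (by simp))) (Subgroup.subset_closure (by simp))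

theorem quotient_mem_steps (hx : IrredundantGenerators x m) {a b : ℕ} (ha : a < m) (hb : b < m)
    (h : (x a)⁻¹ * x b ∈ steps x m) : a = b + 1 ∨ b = a + 1 := by
  obtain ⟨i, hi, h⟩ := mem_steps.1 h
  have := hx.quotient_eq_quotient (by omega) (by omega) ha hb (by omega) h
  omega

theorem one_notMem_steps (hx : IrredundantGenerators x m) : (1 : G) ∉ steps x m := by
  intro h
  obtain ⟨i, hi, h⟩ := mem_steps.1 h
  have := hx.injOn (Set.mem_Iio.2 (by omega)) (Set.mem_Iio.2 hi) (inv_mul_eq_one.1 h)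
  omega

theorem notMem_steps (hx : IrredundantGenerators x m) {i : ℕ} (hi : i < m) : x i ∉ steps x m := by
  intro h
  obtain ⟨j, hj, h⟩ := mem_steps.1 h
  exact hx.quotient_ne (by omega) (by omega) hi h

theorem encard_image (hx : IrredundantGenerators x m) : (x '' Set.Iio m).encard = m := by
  rw [hx.injOn.encard_image]
  simp [Set.encard_eq_coe_toFinset_card]

theorem encard_steps (hx : IrredundantGenerators x m) : (steps x m).encard = (m - 1 : ℕ) := by
  rw [steps, Set.InjOn.encard_image]
  · simp [Set.encard_eq_coe_toFinset_card]
  · intro i hi j hj h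
    rw [Set.mem_Iio] at hi hj
    have := hx.quotient_eq_quotient (by omega) (by omega) (by omega) (by omega) (by omega) h
    omega

end IrredundantGenerators

end Generators

section Paths

/-- Two vertices joined by arcs in both directions. -/
def Bidirected (Γ : Digraph V) (x y : V) : Prop := Γ.Adj x y ∧ Γ.Adj y x

/-- A vertex on exactly one bidirected edge; when the bidirected components are paths, these are
their end vertices. -/
def IsPathEnd (Γ : Digraph V) (x : V) : Prop := ∃! y, Bidirected Γ x y

/-- An end of a bidirected path with an arc to an end of the same path. -/
def IsPathStart (Γ : Digraph V) (x : V) : Prop :=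
  IsPathEnd Γ x ∧ ∃ y, IsPathEnd Γ y ∧ Γ.Adj x y ∧ Relation.ReflTransGen (Bidirected Γ) x y

variable {Γ : Digraph V} {σ : Equiv.Perm V}

theorem bidirected_apply_iff (hσ : σ ∈ Γ.autGroup) {x y : V} :
    Bidirected Γ (σ x) (σ y) ↔ Bidirected Γ x y :=
  and_congr (hσ x y) (hσ y x)

theorem apply_eq_self_of_bidirected (hσ : σ ∈ Γ.autGroup)
    {x y : V} (hx : σ x = x) (hxy : Bidirected Γ x y)
    (hother : ∀ z, Bidirected Γ x z → z ≠ y → σ z = z) : σ y = y := by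
  refine apply_eq_self_of_injective σ.injective (N := {z | Bidirected Γ x z}) ?_ hother
  change Bidirected Γ x (σ y)
  simpa only [hx] using (bidirected_apply_iff hσ).2 hxy

theorem isPathEnd_apply_iff (hσ : σ ∈ Γ.autGroup) {x : V} :
    IsPathEnd Γ (σ x) ↔ IsPathEnd Γ x :=
  (σ.existsUnique_congr fun {_} => (bidirected_apply_iff hσ).symm).symm

theorem IsPathStart.apply (hσ : σ ∈ Γ.autGroup) {x : V} (hx : IsPathStart Γ x) :
    IsPathStart Γ (σ x) := by
  obtain ⟨hx, y, hy, hxy, hpath⟩ := hx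
  exact ⟨(isPathEnd_apply_iff hσ).2 hx, σ y, (isPathEnd_apply_iff hσ).2 hy, (hσ x y).2 hxy,
    hpath.lift σ fun _ _ => (bidirected_apply_iff hσ).2⟩

end Paths

section Cyclic

variable {k : ℕ}

theorem fin_eq_add_one_iff {i j : Fin (k + 3)} :
    j = i + 1 ↔ i.val + 1 = j.val ∨ (i.val = k + 2 ∧ j.val = 0) := by
  rw [Fin.ext_iff, Fin.val_add_one]
  split_ifs with h <;> rw [Fin.ext_iff, Fin.val_last] at h <;> omega

theorem fin_ne_add_one_add_one (i : Fin (k + 3)) : i ≠ i + 1 + 1 := by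
  have hsucc := (fin_eq_add_one_iff (i := i)).1 rfl
  rw [Ne, fin_eq_add_one_iff]
  omega

/-- Connection sets with forward arcs `(g, i) → (g * c, i + 1)`, `c ∈ T i`, and backward arcs
`(g, i + 1) → (g, i)`. -/
def cyclicConnection (T : Fin (k + 3) → Set G) (i j : Fin (k + 3)) : Set G :=
  {c | (j = i + 1 ∧ c ∈ T i) ∨ (i = j + 1 ∧ c = 1)}

variable {T : Fin (k + 3) → Set G}

theorem cyclicConnection_add_one (T : Fin (k + 3) → Set G) (i : Fin (k + 3)) :
    cyclicConnection T i (i + 1) = T i := by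
  simp [cyclicConnection, fin_ne_add_one_add_one]

theorem cyclicConnection_self (T : Fin (k + 3) → Set G) (i : Fin (k + 3)) :
    cyclicConnection T i i = ∅ := by
  simp [cyclicConnection]

theorem encard_cyclicConnection (i j : Fin (k + 3)) :
    (cyclicConnection T i j).encard =
      (if j = i + 1 then (T i).encard else 0) + if i = j + 1 then 1 else 0 := by
  by_cases hj : j = i + 1
  · simp [hj, cyclicConnection_add_one, fin_ne_add_one_add_one]
  · by_cases hi : i = j + 1 <;> simp [cyclicConnection, hj, hi, fin_ne_add_one_add_one]

theorem isRegular_cyclicConnection {d : ℕ} (hT : ∀ i, (T i).encard = d) :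
    (multiCayley (cyclicConnection T)).IsRegular := by
  refine isRegular_multiCayley_iff.2 ⟨d + 1, fun i => ?_⟩
  have hpred : ∀ j, i = j + 1 ↔ j = i - 1 := fun j => eq_comm.trans eq_sub_iff_add_eq.symm
  simp [encard_cyclicConnection, Finset.sum_add_distrib, hT, hpred]

theorem bidirected_cyclicConnection (h1 : ∀ i, (1 : G) ∈ T i ↔ i ≠ Fin.last _)
    {x y : G × Fin (k + 3)} : Bidirected (multiCayley (cyclicConnection T)) x y ↔
      x.1 = y.1 ∧ (x.2.val + 1 = y.2.val ∨ y.2.val + 1 = x.2.val) := by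
  obtain ⟨g, i⟩ := x
  obtain ⟨h, j⟩ := y
  have hi := i.2
  have hj := j.2
  simp only [Bidirected, multiCayley_adj, cyclicConnection, Set.mem_ofPred_eq, inv_mul_eq_one]
  constructor
  · intro hadj
    obtain rfl : g = h := by
      rcases hadj with ⟨⟨hij, -⟩ | ⟨-, hgh⟩, ⟨hji, -⟩ | ⟨-, hhg⟩⟩
      · exact absurd (hij ▸ hji) (fin_ne_add_one_add_one i)
      · exact hhg.symm
      · exact hgh
      · exact hgh
    simp only [inv_mul_cancel, h1, fin_eq_add_one_iff] at hadj
    simp only [Ne, Fin.ext_iff, Fin.val_last] at hadj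
    exact ⟨rfl, by omega⟩
  · rintro ⟨rfl, hij⟩
    simp only [inv_mul_cancel, h1, fin_eq_add_one_iff] at hij ⊢
    simp only [Ne, Fin.ext_iff, Fin.val_last, and_true]
    omega

theorem isPathEnd_cyclicConnection (h1 : ∀ i, (1 : G) ∈ T i ↔ i ≠ Fin.last _)
    {x : G × Fin (k + 3)} : IsPathEnd (multiCayley (cyclicConnection T)) x ↔
      x.2.val = 0 ∨ x.2.val = k + 2 := by
  obtain ⟨g, i⟩ := x
  have hi := i.2
  simp only [IsPathEnd, bidirected_cyclicConnection h1]
  constructor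
  · rintro ⟨y, -, hy⟩
    by_contra! hne
    have hnext := hy (g, ⟨i.val + 1, by omega⟩) ⟨rfl, Or.inl rfl⟩
    have hprev := hy (g, ⟨i.val - 1, by omega⟩) ⟨rfl, Or.inr (by simp; omega)⟩
    have := congrArg (fun y => y.2.val) (hnext.trans hprev.symm)
    simp only at this
    omega
  · intro hends
    obtain ⟨j, hj⟩ : ∃ j : Fin (k + 3), ∀ l : Fin (k + 3),
        i.val + 1 = l.val ∨ l.val + 1 = i.val ↔ l = j := by
      rcases hends with h | h
      · exact ⟨⟨1, by omega⟩, fun l => by rw [Fin.ext_iff]; simp only at h ⊢; omega⟩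
      · exact ⟨⟨k + 1, by omega⟩, fun l => by rw [Fin.ext_iff]; simp only at h ⊢; omega⟩
    refine ⟨(g, j), ⟨rfl, (hj j).2 rfl⟩, ?_⟩
    rintro ⟨_, l⟩ ⟨rfl, hl⟩
    rw [(hj l).1 hl]

theorem fst_eq_of_reflTransGen (h1 : ∀ i, (1 : G) ∈ T i ↔ i ≠ Fin.last _)
    {x y : G × Fin (k + 3)}
    (hxy : Relation.ReflTransGen (Bidirected (multiCayley (cyclicConnection T))) x y) :
    x.1 = y.1 := by
  induction hxy with
  | refl => rfl
  | tail _ h ih => exact ih.trans ((bidirected_cyclicConnection h1).1 h).1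

theorem reflTransGen_bidirected (h1 : ∀ i, (1 : G) ∈ T i ↔ i ≠ Fin.last _) (g : G)
    (i : Fin (k + 3)) :
    Relation.ReflTransGen (Bidirected (multiCayley (cyclicConnection T))) (g, 0) (g, i) := by
  induction i using Fin.induction with
  | zero => exact .refl
  | succ i ih => exact ih.tail ((bidirected_cyclicConnection h1).2 ⟨rfl, Or.inl rfl⟩)

theorem isPathStart_cyclicConnection (h1 : ∀ i, (1 : G) ∈ T i ↔ i ≠ Fin.last _)
    {x : G × Fin (k + 3)} : IsPathStart (multiCayley (cyclicConnection T)) x ↔ x.2 = 0 := by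
  obtain ⟨g, i⟩ := x
  simp only [IsPathStart, isPathEnd_cyclicConnection h1]
  constructor
  · rintro ⟨hx, ⟨h, j⟩, hy, hadj, hpath⟩
    obtain rfl : g = h := fst_eq_of_reflTransGen h1 hpath
    simp only [multiCayley_adj, cyclicConnection, Set.mem_ofPred_eq, inv_mul_cancel, h1,
      fin_eq_add_one_iff] at hadj
    simp only [Fin.ext_iff, Ne, Fin.val_last, Fin.val_zero] at hx hy hadj ⊢
    omega
  · rintro rfl
    refine ⟨by simp, (g, Fin.last _), by simp, ?_, reflTransGen_bidirected h1 g _⟩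
    exact Or.inr ⟨(Fin.last_add_one _).symm, inv_mul_cancel g⟩

theorem exists_fibre_map_cyclicConnection (h1 : ∀ i, (1 : G) ∈ T i ↔ i ≠ Fin.last _)
    {σ : Equiv.Perm (G × Fin (k + 3))} (hσ : σ ∈ (multiCayley (cyclicConnection T)).autGroup) :
    ∃ τ : G → G, ∀ g i, σ (g, i) = (τ g, i) := by
  refine ⟨fun g => (σ (g, 0)).1, fun g => ?_⟩
  suffices ∀ t (ht : t < k + 3), σ (g, ⟨t, ht⟩) = ((σ (g, 0)).1, ⟨t, ht⟩) from fun i => this i i.2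
  intro t
  induction t using Nat.strong_induction_on with
  | _ t ih =>
    intro ht
    obtain _ | t := t
    · exact Prod.ext rfl ((isPathStart_cyclicConnection h1).1
        (((isPathStart_cyclicConnection h1 (x := (g, 0))).2 rfl).apply hσ))
    have hprev := ih t (by omega) (by omega)
    have hbid : Bidirected (multiCayley (cyclicConnection T)) (σ (g, ⟨t, by omega⟩))
        (σ (g, ⟨t + 1, ht⟩)) :=
      (bidirected_apply_iff hσ).2 ((bidirected_cyclicConnection h1).2 ⟨rfl, Or.inl rfl⟩)
    rw [hprev, bidirected_cyclicConnection h1] at hbid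
    refine apply_eq_apply_of_injective (f := fun i => σ (g, i)) (e := fun i => ((σ (g, 0)).1, i))
      (σ.injective.comp (Prod.mk_right_injective g))
      (N := {j | t + 1 = j.val ∨ j.val + 1 = t}) ⟨_, hbid.2, Prod.ext hbid.1 rfl⟩ ?_
    rintro j hj hne
    simp only [Set.mem_ofPred_eq, Ne, Fin.ext_iff] at hj hne
    exact ih j (by omega) j.2

end Cyclic

section ThreeLe

variable {k : ℕ} {x : ℕ → G} {m : ℕ}

/-- The connection sets `T i` of the cyclic digraph attached to generators `x 0, …, x (m - 1)`: the
last one recognizes the generators, the first one singles out `x 0`, the others see a path. -/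
def generatorLayers (x : ℕ → G) (m k : ℕ) (i : Fin (k + 3)) : Set G :=
  if i = Fin.last _ then x '' Set.Iio m
  else if i = 0 then insert 1 (x '' (Set.Iio m \ {0}))
  else insert 1 (steps x m)

theorem generatorLayers_last : generatorLayers x m k (Fin.last _) = x '' Set.Iio m := if_pos rfl

theorem generatorLayers_zero :
    generatorLayers x m k 0 = insert 1 (x '' (Set.Iio m \ {0})) := by
  simp [generatorLayers, Fin.ext_iff]

theorem generatorLayers_one : generatorLayers x m k 1 = insert 1 (steps x m) := by
  simp [generatorLayers, Fin.ext_iff]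

theorem IrredundantGenerators.one_notMem_image (hx : IrredundantGenerators x m) :
    (1 : G) ∉ x '' Set.Iio m := fun ⟨_, hi, h⟩ => hx.ne_one hi h

theorem IrredundantGenerators.one_mem_generatorLayers_iff (hx : IrredundantGenerators x m)
    {i : Fin (k + 3)} : 1 ∈ generatorLayers x m k i ↔ i ≠ Fin.last _ := by
  unfold generatorLayers
  split_ifs with hlast
  · simpa [hlast] using hx.one_notMem_image
  · simp [hlast]
  · simp [hlast]

theorem IrredundantGenerators.encard_generatorLayers (hx : IrredundantGenerators x m) (hm : 0 < m)
    (i : Fin (k + 3)) : (generatorLayers x m k i).encard = m := by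
  unfold generatorLayers
  split_ifs
  · exact hx.encard_image
  · have hone : (1 : G) ∉ x '' (Set.Iio m \ {0}) := fun h =>
      hx.one_notMem_image (Set.image_mono Set.sdiff_subset h)
    rw [Set.encard_insert_of_notMem hone, (hx.injOn.mono Set.sdiff_subset).encard_image,
      Set.encard_sdiff_singleton_add_one (Set.mem_Iio.2 hm), ← hx.injOn.encard_image,
      hx.encard_image]
  · rw [Set.encard_insert_of_notMem hx.one_notMem_steps, hx.encard_steps]
    norm_cast
    omega

theorem IrredundantGenerators.fixes_of_isCayleyEmbedding (hx : IrredundantGenerators x m)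
    (hm : 0 < m) {τ : G → G} (hτ : IsCayleyEmbedding (cyclicConnection (generatorLayers x m k))
      (cyclicConnection (generatorLayers x m k)) τ) (h1 : τ 1 = 1) :
    ∀ i < m, τ (x i) = x i := by
  have hmem : ∀ i g, τ g ∈ generatorLayers x m k i ↔ g ∈ generatorLayers x m k i := fun i g => by
    simpa only [cyclicConnection_add_one] using hτ.apply_mem_iff h1 (i := i) (j := i + 1) (g := g)
  have hlast := hmem (Fin.last _)
  simp only [generatorLayers_last] at hlast
  have hmaps : ∀ i < m, τ (x i) ∈ x '' Set.Iio m := fun i hi => (hlast _).2 ⟨i, hi, rfl⟩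
  have h0 : τ (x 0) = x 0 := by
    have hnot : x 0 ∉ generatorLayers x m k 0 := by
      rw [generatorLayers_zero]
      rintro (h | ⟨i, ⟨hi, hi0⟩, h⟩)
      · exact hx.ne_one hm h
      · exact hi0 (hx.injOn hi hm h)
    obtain ⟨j, hj, hτj⟩ := hmaps 0 hm
    obtain rfl | hj0 := eq_or_ne j 0
    · exact hτj.symm
    · refine absurd ((hmem 0 (x 0)).1 ?_) hnot
      rw [generatorLayers_zero]
      exact Or.inr ⟨j, ⟨hj, hj0⟩, hτj⟩
  refine fixes_of_path (Q := insert 1 (steps x m)) (Set.subset_insert _ _) ?_ hτ.injective ?_ hmaps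
    h0
  · rintro a ha b hb (hab | hab)
    · exact Or.inl (hx.injOn ha hb (inv_mul_eq_one.1 hab))
    · exact Or.inr (hx.quotient_mem_steps ha hb hab)
  · intro g h hgh
    have hone := hτ.mem_iff 1 (1 + 1) g h
    simp only [cyclicConnection_add_one, generatorLayers_one] at hone
    exact hone.2 hgh

theorem admits_of_three_le {G : Type u} [Group G] [Finite G] [Nontrivial G] {n : ℕ} (hn : 3 ≤ n) :
    AdmitsPartiteRepresentation.{u, v} G n := by
  obtain ⟨k, rfl⟩ := Nat.exists_eq_add_of_le' hn
  obtain ⟨x, hx⟩ := exists_irredundantGenerators G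
  have hrank := Group.rank_pos G
  have hconn : IsPartiteConnection (cyclicConnection (generatorLayers x (Group.rank G) k)) :=
    .of_fixes_generators (isRegular_cyclicConnection (hx.encard_generatorLayers hrank))
      (cyclicConnection_self _)
      (fun _ hσ => exists_fibre_map_cyclicConnection (fun _ => hx.one_mem_generatorLayers_iff) hσ)
      hx.closure_eq
      fun _ hτ h1 => Set.forall_mem_image.2 (hx.fixes_of_isCayleyEmbedding hrank hτ h1)
  simpa using hconn.admits

end ThreeLe

section Haar

/-- Connection sets of the Haar digraph, with arcs `(g, false) → (g * r, true)` for `r ∈ R` and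
`(g, true) → (g * l, false)` for `l ∈ L`. -/
def haarConnection (R L : Set V) : Bool → Bool → Set V
  | false, true => R
  | true, false => L
  | _, _ => ∅

variable {R L : Set G}

theorem haarConnection_self (R L : Set V) (i : Bool) : haarConnection R L i i = ∅ := by
  cases i <;> rfl

theorem haarConnection_not (R L : Set V) (i j : Bool) :
    haarConnection R L (!i) (!j) = haarConnection L R i j := by
  cases i <;> cases j <;> rfl

theorem isRegular_haarConnection_iff :
    (multiCayley (haarConnection R L)).IsRegular ↔ R.Finite ∧ R.encard = L.encard := by
  simp only [isRegular_multiCayley_iff, Fintype.sum_bool, Bool.forall_bool, haarConnection,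
    Set.encard_empty, add_zero, zero_add]
  constructor
  · rintro ⟨d, ⟨hR, hL⟩, -⟩
    exact ⟨Set.finite_of_encard_eq_coe hR, hR.trans hL.symm⟩
  · rintro ⟨hfin, hcard⟩
    exact ⟨R.ncard, by simp [← hcard, hfin.cast_ncard_eq]⟩

theorem bidirected_haarConnection (hRL : ∀ c ∈ R, c⁻¹ ∉ L) {x y : G × Bool} :
    Bidirected (multiCayley (haarConnection (insert 1 R) (insert 1 L))) x y ↔
      y = (x.1, !x.2) := by
  have hone : ∀ c : G, c ∈ insert 1 R → c⁻¹ ∈ insert 1 L → c = 1 := by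
    rintro c (hc | hc) (hc' | hc')
    · exact hc
    · exact hc
    · exact inv_eq_one.1 hc'
    · exact absurd hc' (hRL c hc)
  obtain ⟨g, _ | _⟩ := x <;> obtain ⟨h, _ | _⟩ := y <;>
    simp only [Bidirected, multiCayley_adj, haarConnection, Set.mem_empty_iff_false, and_self,
      Prod.mk.injEq, Bool.not_false, Bool.not_true, reduceCtorEq, and_false, and_true]
  · exact ⟨fun h => (inv_mul_eq_one.1 (hone _ h.1 (by simpa using h.2))).symm, fun h => by simp [h]⟩
  · exact ⟨fun h => inv_mul_eq_one.1 (hone _ h.2 (by simpa using h.1)), fun h => by simp [h]⟩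

theorem eq_not_of_adj_haarConnection {x y : G × Bool}
    (hxy : (multiCayley (haarConnection R L)).Adj x y) : y.2 = !x.2 := by
  obtain ⟨g, _ | _⟩ := x <;> obtain ⟨h, _ | _⟩ := y <;> first | rfl | exact hxy.elim

/-- Bidirected arcs match the two copies of each group element, and stepping along `R` and back
along the matching stays on the same side. -/
theorem exists_fibre_map_haarConnection (hRL : ∀ c ∈ R, c⁻¹ ∉ L)
    (hR : Subgroup.closure R = ⊤) {σ : Equiv.Perm (G × Bool)}
    (hσ : σ ∈ (multiCayley (haarConnection (insert 1 R) (insert 1 L))).autGroup) :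
    ∃ (τ : G → G) (b : Bool), ∀ g i, σ (g, i) = (τ g, i ^^ b) := by
  have hflip : ∀ g i, σ (g, !i) = ((σ (g, i)).1, !(σ (g, i)).2) := fun g i => by
    rw [← bidirected_haarConnection hRL, bidirected_apply_iff hσ, bidirected_haarConnection hRL]
  have hstep : ∀ g, ∀ r ∈ R, (σ (g * r, false)).2 = (σ (g, false)).2 := by
    intro g r hr
    have hadj : (multiCayley (haarConnection (insert 1 R) (insert 1 L))).Adj
        (g, false) (g * r, !false) := by simp [multiCayley_adj, haarConnection, hr]
    have hsides := eq_not_of_adj_haarConnection ((hσ _ _).2 hadj)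
    rw [hflip] at hsides
    exact Bool.not_inj hsides
  have hclosure : ∀ c ∈ Subgroup.closure R, ∀ g, (σ (g * c, false)).2 = (σ (g, false)).2 := by
    intro c hc
    induction hc using Subgroup.closure_induction with
    | mem r hr => exact fun g => hstep g r hr
    | one => simp
    | mul a b _ _ iha ihb => exact fun g => by rw [← mul_assoc, ihb, iha]
    | inv a _ iha => exact fun g => by simpa using (iha (g * a⁻¹)).symm
  have hconst : ∀ g, (σ (g, false)).2 = (σ (1, false)).2 := fun g => by
    simpa using hclosure g (hR ▸ Subgroup.mem_top g) 1
  refine ⟨fun g => (σ (g, false)).1, (σ (1, false)).2, fun g i => ?_⟩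
  cases i
  · exact Prod.ext rfl (by simp [hconst g])
  · simpa [hconst g] using hflip g false

theorem IsCayleyEmbedding.of_insert_one {R' L' : Set G} {τ : G → G}
    (hτ : IsCayleyEmbedding (haarConnection (insert 1 R) (insert 1 L))
      (haarConnection (insert 1 R') (insert 1 L')) τ)
    (hR : 1 ∉ R) (hL : 1 ∉ L) (hR' : 1 ∉ R') (hL' : 1 ∉ L') :
    IsCayleyEmbedding (haarConnection R L) (haarConnection R' L') τ := by
  have hremove : ∀ {A A' : Set G} (g h : G), 1 ∉ A → 1 ∉ A' →
      ((τ g)⁻¹ * τ h ∈ insert 1 A' ↔ g⁻¹ * h ∈ insert 1 A) →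
      ((τ g)⁻¹ * τ h ∈ A' ↔ g⁻¹ * h ∈ A) := by
    intro A A' g h hA hA' hiff
    obtain rfl | hgh := eq_or_ne g h
    · simp [hA, hA']
    · simpa [inv_mul_eq_one, hgh, hτ.injective.ne hgh] using hiff
  refine ⟨hτ.injective, ?_⟩
  rintro (_ | _) (_ | _) g h
  · rfl
  · exact hremove g h hR hR' (hτ.mem_iff false true g h)
  · exact hremove g h hL hL' (hτ.mem_iff true false g h)
  · rfl

theorem isCayleyEmbedding_of_mem_autGroup {τ : G → G} {b : Bool} {σ : Equiv.Perm (G × Bool)}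
    (hσ : σ ∈ (multiCayley (haarConnection R L)).autGroup) (hτ : ∀ g i, σ (g, i) = (τ g, i ^^ b)) :
    IsCayleyEmbedding (haarConnection R L)
      (fun i j => haarConnection R L (i ^^ b) (j ^^ b)) τ := by
  refine ⟨fun g h hgh => ?_, fun i j g h => ?_⟩
  · exact congrArg Prod.fst (σ.injective (a₁ := (g, false)) (a₂ := (h, false)) (by simp [hτ, hgh]))
  · simpa only [hτ, multiCayley_adj] using hσ (g, i) (h, j)

theorem isPartiteConnection_haarConnection (hfin : R.Finite) (hcard : R.encard = L.encard)
    (hR1 : 1 ∉ R) (hL1 : 1 ∉ L) (hRL : ∀ c ∈ R, c⁻¹ ∉ L) (hR : Subgroup.closure R = ⊤)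
    (hfix : ∀ τ, IsCayleyEmbedding (haarConnection R L) (haarConnection R L) τ → τ 1 = 1 →
      ∀ r ∈ R, τ r = r)
    (hswap : ∀ τ, IsCayleyEmbedding (haarConnection R L) (haarConnection L R) τ → τ 1 ≠ 1) :
    IsPartiteConnection (haarConnection (insert 1 R) (insert 1 L)) := by
  refine .of_fixes_generators (isRegular_haarConnection_iff.2 ⟨hfin.insert 1, ?_⟩)
    (haarConnection_self _ _) (fun σ hσ => ?_) hR
    fun τ hτ => hfix τ (hτ.of_insert_one hR1 hL1 hR1 hL1)
  · rw [Set.encard_insert_of_notMem hR1, Set.encard_insert_of_notMem hL1, hcard]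
  · obtain ⟨τ, _ | _, hτ⟩ := exists_fibre_map_haarConnection hRL hR hσ
    · exact ⟨τ, by simpa using hτ⟩
    · have hembed := isCayleyEmbedding_of_mem_autGroup hσ hτ
      simp only [Bool.xor_true, haarConnection_not] at hembed
      have hembed' := (hembed.of_insert_one hR1 hL1 hL1 hR1).mul_comp_mul (τ 1)⁻¹ 1
      exact absurd (by simp) (hswap _ hembed')

end Haar

section Two

theorem admits_two_of_haarConnection {G : Type u} [Group G] [Finite G] {R L : Set G}
    (h : IsPartiteConnection (haarConnection R L)) : AdmitsPartiteRepresentation.{u, v} G 2 := by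
  simpa using h.admits

variable {R L : Set G} {τ : G → G}

theorem admits_two_of_isCyclic {G : Type u} [Group G] [Finite G] [IsCyclic G]
    (hG : 4 ≤ Nat.card G) : AdmitsPartiteRepresentation.{u, v} G 2 := by
  obtain ⟨x, hx⟩ := IsCyclic.exists_zpow_surjective (G := G)
  have hord : orderOf x = Nat.card G := orderOf_eq_card_of_forall_mem_zpowers hx
  have hpow : ∀ k, 0 < k → k < 4 → x ^ k ≠ 1 := fun k h0 h4 h =>
    absurd (orderOf_le_of_pow_eq_one h0 h) (by omega)
  have hx1 : x ≠ 1 := by simpa using hpow 1 (by omega) (by omega)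
  have hx2 := hpow 2 (by omega) (by omega)
  have hx3 := hpow 3 (by omega) (by omega)
  refine admits_two_of_haarConnection <| isPartiteConnection_haarConnection (R := {x})
    (L := {x ^ 2}) (Set.finite_singleton x) (by simp) (Ne.symm hx1) (Ne.symm hx2) ?_ ?_ ?_ ?_
  · rintro _ rfl hmem
    exact hx3 (by rw [pow_succ, ← Set.mem_singleton_iff.1 hmem, inv_mul_cancel])
  · rw [eq_top_iff, ← Subgroup.zpowers_eq_closure]
    exact fun g _ => hx g
  · rintro τ hτ h1 _ rfl
    exact (hτ.apply_mem_iff h1 (i := false) (j := true)).2 rfl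
  · intro τ hτ h1
    have hτx : τ x = x ^ 2 := (hτ.apply_mem_iff h1 (i := false) (j := true)).2 rfl
    have hτx2 : τ (x ^ 2) = x := (hτ.apply_mem_iff h1 (i := true) (j := false)).2 rfl
    have hquot : (τ x)⁻¹ * τ (x ^ 2) = x ^ 2 :=
      (hτ.mem_iff false true x (x ^ 2)).2 (by simp [haarConnection, pow_two])
    rw [hτx, hτx2, pow_two, mul_inv_rev, inv_mul_cancel_right] at hquot
    exact hx3 (by rw [pow_succ, pow_two, ← hquot, inv_mul_cancel])

namespace IrredundantGenerators

variable {x : ℕ → G} {m : ℕ}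

theorem mul_eq_quotient (hx : IrredundantGenerators x m) {a b c d : ℕ} (ha : a < m) (hb : b < m)
    (hc : c < m) (hd : d < m) (hab : a ≠ b) (h : (x a)⁻¹ * x b = x c * x d) :
    (a = c ∧ b = d) ∨ (a = d ∧ b = c) :=
  hx.eq_or_eq_of_quotient_mem_closure ha hb hc hd hab <| h ▸
    mul_mem (Subgroup.subset_closure (by simp)) (Subgroup.subset_closure (by simp))

theorem inv_notMem_steps (hx : IrredundantGenerators x m) {i : ℕ} (hi : i < m) :
    (x i)⁻¹ ∉ steps x m := by
  intro h
  obtain ⟨j, hj, h⟩ := mem_steps.1 h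
  exact hx.quotient_ne (b := j) hj (by omega) hi (by simpa using congrArg (·⁻¹) h)

/-- The rigidity criterion for Haar digraphs with `R` the set of generators and `L` the steps
together with one more element `y`. -/
theorem isPartiteConnection_of_insert_steps (hx : IrredundantGenerators x m)
    (hm : 0 < m) {y : G} (hy1 : y ≠ 1) (hysteps : y ∉ steps x m) (hyinv : ∀ i < m, (x i)⁻¹ ≠ y)
    (hyquot : ∀ a < m, ∀ b < m, (x a)⁻¹ * x b ≠ y)
    (hfix : ∀ τ, IsCayleyEmbedding (haarConnection (x '' Set.Iio m) (insert y (steps x m)))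
      (haarConnection (x '' Set.Iio m) (insert y (steps x m))) τ → τ 1 = 1 → τ (x 0) = x 0)
    (hswap : ∀ τ, IsCayleyEmbedding (haarConnection (x '' Set.Iio m) (insert y (steps x m)))
      (haarConnection (insert y (steps x m)) (x '' Set.Iio m)) τ → τ 1 ≠ 1) :
    IsPartiteConnection (haarConnection (insert 1 (x '' Set.Iio m))
      (insert 1 (insert y (steps x m)))) := by
  refine isPartiteConnection_haarConnection (Set.toFinite _) ?_ hx.one_notMem_image ?_ ?_
    hx.closure_eq (fun τ hτ h1 => Set.forall_mem_image.2 ?_) hswap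
  · rw [hx.encard_image, Set.encard_insert_of_notMem hysteps, hx.encard_steps]
    norm_cast
    omega
  · rintro (h | h)
    · exact hy1 h.symm
    · exact hx.one_notMem_steps h
  · rintro _ ⟨i, hi, rfl⟩ (h | h)
    · exact hyinv i hi h
    · exact hx.inv_notMem_steps hi h
  · refine fixes_of_path (Set.subset_insert y _) ?_ hτ.injective
      (fun g h => (hτ.mem_iff true false g h).2)
      (fun i hi => (hτ.apply_mem_iff h1 (i := false) (j := true)).2 ⟨i, hi, rfl⟩) (hfix τ hτ h1)
    rintro a ha b hb (hab | hab)
    · exact absurd hab (hyquot a ha b hb)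
    · exact Or.inr (hx.quotient_mem_steps ha hb hab)

theorem isPartiteConnection_of_sq_ne_one (hx : IrredundantGenerators x m) (hm : 2 ≤ m)
    (h0 : x 0 ^ 2 ≠ 1) :
    IsPartiteConnection (haarConnection (insert 1 (x '' Set.Iio m))
      (insert 1 (insert (x 0) (steps x m)))) := by
  have hm0 : 0 < m := by omega
  have h0inv : (x 0)⁻¹ ≠ x 0 := fun h => h0 (by rw [pow_two, mul_eq_one_iff_inv_eq, h])
  have hinter : ∀ g, g ∈ x '' Set.Iio m → g ∈ insert (x 0) (steps x m) → g = x 0 := by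
    rintro _ ⟨i, hi, rfl⟩ (h | h)
    · exact h
    · exact absurd h (hx.notMem_steps hi)
  refine hx.isPartiteConnection_of_insert_steps hm0 (hx.ne_one hm0) (hx.notMem_steps hm0) ?_
    (fun a ha b hb => hx.quotient_ne ha hb hm0) (fun τ hτ h1 => ?_) (fun τ hτ h1 => ?_)
  · intro i hi h
    obtain rfl | hi0 := eq_or_ne i 0
    · exact h0inv h
    · exact hx.notMem 0 hm0 (h ▸ inv_mem (mem_othersClosure x hi hi0))
  · exact hinter _ ((hτ.apply_mem_iff h1 (i := false) (j := true)).2 ⟨0, hm0, rfl⟩)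
      ((hτ.apply_mem_iff h1 (i := true) (j := false)).2 (Or.inl rfl))
  · have hτ0 : τ (x 0) = x 0 :=
      hinter _ ((hτ.apply_mem_iff h1 (i := true) (j := false)).2 (Or.inl rfl))
        ((hτ.apply_mem_iff h1 (i := false) (j := true)).2 ⟨0, hm0, rfl⟩)
    obtain ⟨k, hk, hτ1⟩ : (τ (x 0))⁻¹ * τ (x 1) ∈ x '' Set.Iio m :=
      (hτ.mem_iff true false _ _).2 (Or.inr (mem_steps.2 ⟨0, by omega, rfl⟩))
    rw [hτ0, eq_inv_mul_iff_mul_eq] at hτ1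
    obtain h | h : τ (x 1) ∈ insert (x 0) (steps x m) :=
      (hτ.apply_mem_iff h1 (i := false) (j := true)).2 ⟨1, hm, rfl⟩
    · exact hx.ne_one hk (by simpa [← hτ1] using h)
    · obtain ⟨i, hi, h⟩ := mem_steps.1 h
      rw [← hτ1] at h
      obtain ⟨rfl, rfl⟩ : i = 0 ∧ k = i + 1 := by
        have := hx.mul_eq_quotient (by omega) hi hm0 hk (by omega) h
        omega
      exact h0inv (mul_right_cancel h)

section ExponentTwo

variable {G : Type*} [CommGroup G] {x : ℕ → G} {m : ℕ}

theorem exists_prod_eq_pow_count_mul (x : ℕ → G) (k : ℕ) {l : List ℕ} (hl : ∀ i ∈ l, i < m) :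
    ∃ c ∈ othersClosure x m k, (l.map x).prod = x k ^ l.count k * c := by
  induction l with
  | nil => exact ⟨1, one_mem _, by simp⟩
  | cons i l ih =>
    obtain ⟨c, hc, h⟩ := ih fun j hj => hl j (List.mem_cons_of_mem _ hj)
    obtain rfl | hik := eq_or_ne i k
    · exact ⟨c, hc, by simp only [List.map_cons, List.prod_cons, h, List.count_cons_self, pow_succ',
        mul_assoc]⟩
    · refine ⟨x i * c, mul_mem (mem_othersClosure x (hl i List.mem_cons_self) hik) hc, ?_⟩
      simp [h, hik, mul_left_comm]

theorem inv_eq_self (hexp : ∀ g : G, g ^ 2 = 1) (g : G) : g⁻¹ = g :=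
  inv_eq_of_mul_eq_one_left (by rw [← pow_two, hexp])

theorem even_count (hx : IrredundantGenerators x m) (hexp : ∀ g : G, g ^ 2 = 1) {l : List ℕ}
    (hl : ∀ i ∈ l, i < m) (h : (l.map x).prod = 1) (k : ℕ) : Even (l.count k) := by
  by_cases hk : k < m
  · obtain ⟨c, hc, hprod⟩ := exists_prod_eq_pow_count_mul x k hl
    by_contra hodd
    obtain ⟨t, ht⟩ := Nat.not_even_iff_odd.1 hodd
    rw [h, ht, pow_succ, pow_mul, hexp, one_pow, one_mul] at hprod
    exact hx.notMem k hk ((Subgroup.mul_mem_cancel_right _ hc).1 (hprod ▸ one_mem _))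
  · rw [List.count_eq_zero_of_not_mem fun hmem => hk (hl k hmem)]
    exact Even.zero

theorem even_length (hx : IrredundantGenerators x m) (hexp : ∀ g : G, g ^ 2 = 1) {l : List ℕ}
    (hl : ∀ i ∈ l, i < m) (h : (l.map x).prod = 1) : Even l.length := by
  rw [← List.sum_toFinset_count_eq_length]
  exact Finset.even_sum _ fun k _ => hx.even_count hexp hl h k

theorem eq_zero_of_prod_eq_one (hx : IrredundantGenerators x m) (hexp : ∀ g : G, g ^ 2 = 1)
    (hm : 4 ≤ m) {a c : ℕ} (ha : a + 1 < m) (hc : c < m)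
    (h : ([c, 0, 2, 3, a, a + 1].map x).prod = 1) : c = 0 := by
  have heven := hx.even_count hexp (by simp; omega) h
  have h0 := heven 0
  have h2 := heven 2
  have h3 := heven 3
  simp only [List.count_cons, List.count_nil, beq_iff_eq, Nat.even_iff] at h0 h2 h3
  grind

/-- With `L = insert (x 0 * (x 2 * x 3)) (steps x m)`, the arcs of `Cay(G, L)` within `L` by a
generator `x c` come from the single relation between `x 0`, `x 2 * x 3` and their product. -/
theorem eq_zero_of_inv_mul_mem (hx : IrredundantGenerators x m) (hexp : ∀ g : G, g ^ 2 = 1)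
    (hm : 4 ≤ m) {c : ℕ} (hc : c < m) {l : G} (hl : l ∈ insert (x 0 * (x 2 * x 3)) (steps x m))
    (h : (x c)⁻¹ * l ∈ insert (x 0 * (x 2 * x 3)) (steps x m)) : c = 0 := by
  have hword : ∀ w w' : List ℕ, (x c)⁻¹ * (w.map x).prod = (w'.map x).prod →
      ((c :: (w ++ w')).map x).prod = 1 := by
    intro w w' h
    rw [List.map_cons, List.map_append, List.prod_cons, List.prod_append, ← h, mul_left_comm,
      mul_inv_cancel_left, ← pow_two, hexp]
  have hstep : ∀ a, ([a, a + 1].map x).prod = (x a)⁻¹ * x (a + 1) := fun a => by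
    rw [inv_eq_self hexp, List.map_cons, List.prod_cons, List.map_singleton, List.prod_singleton]
  have hy : ([0, 2, 3].map x).prod = x 0 * (x 2 * x 3) := by simp
  obtain rfl | hl := hl
  · obtain h | h := h
    · exact absurd (inv_eq_one.1 (mul_eq_right.1 h)) (hx.ne_one hc)
    · obtain ⟨a, ha, h⟩ := mem_steps.1 h
      exact hx.eq_zero_of_prod_eq_one hexp hm ha hc
        (hword [0, 2, 3] [a, a + 1] (by rw [hy, hstep, h]))
  · obtain ⟨a, ha, rfl⟩ := mem_steps.1 hl
    obtain h | h := h
    · refine hx.eq_zero_of_prod_eq_one hexp hm ha hc ?_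
      have hprod := hword [a, a + 1] [0, 2, 3] (by rw [hy, hstep, h])
      rwa [(List.perm_append_comm.cons c).map x |>.prod_eq] at hprod
    · obtain ⟨b, hb, h⟩ := mem_steps.1 h
      have hprod := hword [a, a + 1] [b, b + 1] (by rw [hstep, hstep, h])
      have hlength := hx.even_length hexp (by simp; omega) hprod
      simp only [List.length_cons, List.length_append, List.length_nil] at hlength
      exact absurd hlength (by decide)

theorem quotient_ne_mul_mul (hx : IrredundantGenerators x m) (hexp : ∀ g : G, g ^ 2 = 1)
    {a b c d e : ℕ} (ha : a < m) (hb : b < m) (hc : c < m) (hd : d < m) (he : e < m) :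
    (x a)⁻¹ * x b ≠ x c * (x d * x e) := by
  intro h
  have hodd : Odd [a, b, c, d, e].length := ⟨2, rfl⟩
  refine Nat.not_even_iff_odd.2 hodd (hx.even_length hexp (by simp; omega) ?_)
  simpa [inv_eq_self hexp, ← mul_assoc] using inv_mul_eq_one.2 h

theorem inv_ne_mul_mul (hx : IrredundantGenerators x m) (hexp : ∀ g : G, g ^ 2 = 1) {i c d e : ℕ}
    (hi : i < m) (hc : c < m) (hd : d < m) (he : e < m) (hcd : c ≠ d) (hce : c ≠ e)
    (hde : d ≠ e) : (x i)⁻¹ ≠ x c * (x d * x e) := by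
  intro h
  have heven := hx.even_count hexp (l := [i, c, d, e]) (by simp; omega)
    (by simpa [inv_eq_self hexp] using inv_mul_eq_one.2 h)
  have hc := heven c
  have hd := heven d
  simp only [List.count_cons, List.count_nil, beq_iff_eq, Nat.even_iff] at hc hd
  grind

theorem isPartiteConnection_of_exponent_two (hx : IrredundantGenerators x m)
    (hexp : ∀ g : G, g ^ 2 = 1) (hm : 4 ≤ m) :
    IsPartiteConnection (haarConnection (insert 1 (x '' Set.Iio m))
      (insert 1 (insert (x 0 * (x 2 * x 3)) (steps x m)))) := by
  have hm0 : 0 < m := by omega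
  have hquot : ∀ a < m, ∀ b < m, (x a)⁻¹ * x b ≠ x 0 * (x 2 * x 3) := fun a ha b hb =>
    hx.quotient_ne_mul_mul hexp ha hb hm0 (by omega) (by omega)
  have hinv : ∀ i < m, (x i)⁻¹ ≠ x 0 * (x 2 * x 3) := fun i hi =>
    hx.inv_ne_mul_mul hexp hi hm0 (by omega) (by omega) (by omega) (by omega) (by omega)
  refine hx.isPartiteConnection_of_insert_steps hm0 ?_ ?_ hinv hquot ?_ ?_
  · exact fun h => hquot 0 hm0 0 hm0 (by rw [h, inv_mul_cancel])
  · intro h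
    obtain ⟨i, hi, h⟩ := mem_steps.1 h
    exact hquot i (by omega) (i + 1) hi h
  · intro τ hτ h1
    obtain ⟨c, hc, hτc⟩ : τ (x 0) ∈ x '' Set.Iio m :=
      (hτ.apply_mem_iff h1 (i := false) (j := true)).2 ⟨0, hm0, rfl⟩
    have hτy := (hτ.apply_mem_iff h1 (i := true) (j := false)).2 (Set.mem_insert _ _)
    have harc := (hτ.mem_iff true false (x 0) (x 0 * (x 2 * x 3))).2
      (Or.inr (mem_steps.2 ⟨2, by omega, by rw [inv_mul_cancel_left, inv_eq_self hexp]⟩))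
    rw [← hτc] at harc ⊢
    rw [hx.eq_zero_of_inv_mul_mem hexp hm hc hτy harc]
  · intro τ hτ h1
    have hstep : ∀ i, i + 1 < m → τ ((x i)⁻¹ * x (i + 1)) = x 0 := by
      intro i hi
      obtain ⟨c, hc, hτc⟩ : τ ((x i)⁻¹ * x (i + 1)) ∈ x '' Set.Iio m :=
        (hτ.apply_mem_iff h1 (i := true) (j := false)).2 (Or.inr (mem_steps.2 ⟨i, hi, rfl⟩))
      have hτx := (hτ.apply_mem_iff h1 (i := false) (j := true)).2 ⟨i + 1, hi, rfl⟩
      have harc := (hτ.mem_iff false true ((x i)⁻¹ * x (i + 1)) (x (i + 1))).2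
        ⟨i, Set.mem_Iio.2 (by omega), by simp⟩
      rw [← hτc] at harc ⊢
      rw [hx.eq_zero_of_inv_mul_mem hexp hm hc hτx harc]
    have hsteps := hτ.injective ((hstep 0 (by omega)).trans (hstep 1 (by omega)).symm)
    have := hx.quotient_eq_quotient hm0 (by omega) (by omega) (by omega) (by omega) hsteps
    omega

end ExponentTwo

end IrredundantGenerators

theorem admits_two_of_exponent_two {G : Type u} [CommGroup G] [Finite G]
    (hexp : ∀ g : G, g ^ 2 = 1) (hrank : 4 ≤ Group.rank G) :
    AdmitsPartiteRepresentation.{u, v} G 2 := by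
  obtain ⟨x, hx⟩ := exists_irredundantGenerators G
  exact admits_two_of_haarConnection (hx.isPartiteConnection_of_exponent_two hexp hrank)

theorem isCyclic_of_rank_le_one [Group.FG G] (h : Group.rank G ≤ 1) : IsCyclic G := by
  obtain ⟨S, hcard, hS⟩ := Group.rank_spec G
  obtain ⟨s, hs⟩ := Finset.card_le_one_iff_subset_singleton.1 (hcard.trans_le h)
  have htop : Subgroup.zpowers s = ⊤ := by
    rw [eq_top_iff, ← hS, Subgroup.zpowers_eq_closure]
    exact Subgroup.closure_mono (by simpa using Finset.coe_subset.2 hs)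
  exact ⟨s, fun g => Subgroup.mem_zpowers_iff.1 (htop ▸ Subgroup.mem_top g)⟩

theorem mulEquiv_zmod_three (hG : Nat.card G = 3) : Nonempty (G ≃* Multiplicative (ZMod 3)) := by
  have : Fact (Nat.Prime 3) := ⟨Nat.prime_three⟩
  exact ⟨mulEquivOfPrimeCardEq hG (by simp)⟩

theorem mulEquiv_zmod_one [Subsingleton G] : Nonempty (G ≃* Multiplicative (ZMod 1)) :=
  have : Subsingleton (Multiplicative (ZMod 1)) := inferInstanceAs (Subsingleton (Fin 1))
  ⟨⟨equivOfSubsingletonOfSubsingleton 1 1, fun _ _ => Subsingleton.elim _ _⟩⟩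

theorem admits_two_or_card_eq_three {G : Type u} [Group G] [Finite G] {g : G} (hg : g ^ 2 ≠ 1) :
    AdmitsPartiteRepresentation.{u, v} G 2 ∨ Nat.card G = 3 := by
  by_cases hrank : 2 ≤ Group.rank G
  · obtain ⟨x, hx, hx0⟩ := exists_irredundantGenerators_sq_ne_one ⟨g, hg⟩
    exact Or.inl (admits_two_of_haarConnection (hx.isPartiteConnection_of_sq_ne_one hrank hx0))
  have hcyc : IsCyclic G := isCyclic_of_rank_le_one (by omega)
  by_cases hcard : 4 ≤ Nat.card G
  · exact Or.inl (admits_two_of_isCyclic hcard)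
  · have hdvd : ¬Nat.card G ∣ 2 := fun h => hg <| by
      obtain ⟨k, hk⟩ := h
      rw [hk, pow_mul, pow_card_eq_one', one_pow]
    have hpos : 0 < Nat.card G := Nat.card_pos
    right
    interval_cases Nat.card G <;> simp_all

theorem mulEquiv_of_rank_lt_four {G : Type*} [CommGroup G] [Finite G] (hexp : ∀ g : G, g ^ 2 = 1)
    (hrank : Group.rank G < 4) :
    Nonempty (G ≃* Multiplicative (ZMod 1)) ∨ Nonempty (G ≃* Multiplicative (ZMod 2)) ∨
      Nonempty (G ≃* Multiplicative (ZMod 2 × ZMod 2)) ∨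
      Nonempty (G ≃* Multiplicative (ZMod 2 × ZMod 2 × ZMod 2)) := by
  let : Module (ZMod 2) (Additive G) := AddCommGroup.zmodModule fun g => hexp g.toMul
  have hiso : ∀ (M : Type) [AddCommGroup M] [Module (ZMod 2) M] [Module.Finite (ZMod 2) M],
      Module.finrank (ZMod 2) (Additive G) = Module.finrank (ZMod 2) M →
      Nonempty (G ≃* Multiplicative M) := fun M _ _ _ h =>
    ⟨AddEquiv.toMultiplicativeRight (LinearEquiv.ofFinrankEq _ _ h).toAddEquiv⟩
  have hle : Module.finrank (ZMod 2) (Additive G) ≤ Group.rank G := by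
    rw [← Nat.pow_dvd_pow_iff_le_right' (b := 0)]
    have hcard := Module.natCard_eq_pow_finrank (K := ZMod 2) (V := Additive G)
    rw [Nat.card_zmod] at hcard
    exact hcard ▸ card_dvd_exponent_pow_rank' G hexp
  obtain h | h | h | h : Module.finrank (ZMod 2) (Additive G) = 0 ∨
    Module.finrank (ZMod 2) (Additive G) = 1 ∨ Module.finrank (ZMod 2) (Additive G) = 2 ∨
    Module.finrank (ZMod 2) (Additive G) = 3 := by omega
  · have : Subsingleton G := (Module.finrank_zero_iff (R := ZMod 2) (M := Additive G)).1 h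
    exact Or.inl mulEquiv_zmod_one
  · exact Or.inr (Or.inl (hiso _ (by simp [h])))
  · exact Or.inr (Or.inr (Or.inl (hiso _ (by simp [h]))))
  · exact Or.inr (Or.inr (Or.inr (hiso _ (by simp [h]))))

theorem admits_two_or_mulEquiv (G : Type u) [Group G] [Finite G] :
    AdmitsPartiteRepresentation.{u, v} G 2 ∨
      Nonempty (G ≃* Multiplicative (ZMod 1)) ∨
      Nonempty (G ≃* Multiplicative (ZMod 2)) ∨
      Nonempty (G ≃* Multiplicative (ZMod 3)) ∨
      Nonempty (G ≃* Multiplicative (ZMod 2 × ZMod 2)) ∨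
      Nonempty (G ≃* Multiplicative (ZMod 2 × ZMod 2 × ZMod 2)) := by
  by_cases hexp : ∀ g : G, g ^ 2 = 1
  · let : CommGroup G :=
      { ‹Group G› with
        mul_comm := Commute.of_orderOf_dvd_two fun g => orderOf_dvd_of_pow_eq_one (hexp g) }
    by_cases hrank : 4 ≤ Group.rank G
    · exact Or.inl (admits_two_of_exponent_two hexp hrank)
    · have := mulEquiv_of_rank_lt_four hexp (not_le.1 hrank)
      tauto
  · push Not at hexp
    obtain ⟨g, hg⟩ := hexp
    obtain h | h := admits_two_or_card_eq_three hg
    · exact Or.inl h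
    · exact Or.inr (Or.inr (Or.inr (Or.inl (mulEquiv_zmod_three h))))

end Two

section AffineSymmetry

variable {M N : Type*} [AddCommGroup M] [AddCommGroup N]

/-- A nontrivial affine symmetry of the pair `(R, L)`, or an affine map exchanging `R` and `L`. -/
def AffinelySymmetric (R L : Set M) : Prop :=
  ∃ a : M ≃ᵃ[ℤ] M, (a ≠ 1 ∧ a ⁻¹' R = R ∧ a ⁻¹' L = L) ∨ (a ⁻¹' R = L ∧ a ⁻¹' L = R)

/-- All pairs of equinumerous subsets of `M` are affinely symmetric. -/
def HasAffineSymmetries (M : Type*) [AddCommGroup M] : Prop :=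
  ∀ R L : Set M, R.encard = L.encard → AffinelySymmetric R L

theorem AffinelySymmetric.of_compl {R L : Set M} (h : AffinelySymmetric Rᶜ Lᶜ) :
    AffinelySymmetric R L := by
  simpa only [AffinelySymmetric, Set.preimage_compl, compl_inj_iff] using h

theorem AffinelySymmetric.image {R L : Set M} (h : AffinelySymmetric R L) (e : M ≃ᵃ[ℤ] N) :
    AffinelySymmetric (e '' R) (e '' L) := by
  obtain ⟨a, ha⟩ := h
  have hpre (X Y : Set M) (hXY : a ⁻¹' X = Y) :
      (e.symm.trans (a.trans e)) ⁻¹' (e '' X) = e '' Y := by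
    subst hXY
    ext x
    obtain ⟨y, rfl⟩ := e.surjective x
    simp [e.injective.mem_set_image]
  refine ⟨e.symm.trans (a.trans e), ha.imp ?_ ?_⟩
  · rintro ⟨hne, hR, hL⟩
    refine ⟨fun hone => hne (AffineEquiv.ext fun x => e.injective ?_), hpre _ _ hR, hpre _ _ hL⟩
    simpa using DFunLike.congr_fun hone (e x)
  · exact fun ⟨hR, hL⟩ => ⟨hpre _ _ hR, hpre _ _ hL⟩

end AffineSymmetry

section Small

variable {M : Type*} [AddCommGroup M]

theorem exists_perm_exchanging [Finite V] {R L : Set V} (h : R.encard = L.encard) :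
    ∃ σ : Equiv.Perm V, σ ⁻¹' R = L ∧ σ ⁻¹' L = R := by
  let f : V → Prop × Prop := fun x => (x ∈ L, x ∈ R)
  let g : V → Prop × Prop := fun x => (x ∈ R, x ∈ L)
  have hdiff : Nat.card ↥(L \ R) = Nat.card ↥(R \ L) := congrArg ENat.toNat <|
    (Set.encard_eq_encard_iff_encard_sdiff_eq_encard_sdiff (Set.toFinite _)).1 h.symm
  obtain ⟨e⟩ := Finite.card_eq.1 hdiff
  have hfibre : ∀ c, Nonempty ({x // f x = c} ≃ {x // g x = c}) := by
    rintro ⟨p, q⟩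
    rcases Classical.propComplete p with rfl | rfl <;>
      rcases Classical.propComplete q with rfl | rfl <;>
      simp only [f, g, Prod.mk.injEq, eq_iff_iff, iff_true, iff_false]
    · exact ⟨Equiv.subtypeEquivRight fun x => and_comm⟩
    · exact ⟨e⟩
    · exact ⟨(Equiv.subtypeEquivRight fun x => and_comm).trans <|
        e.symm.trans (Equiv.subtypeEquivRight fun x => and_comm)⟩
    · exact ⟨Equiv.subtypeEquivRight fun x => and_comm⟩
  let σ := Equiv.ofFiberEquiv fun c => (hfibre c).some
  have hσ : ∀ x, (σ x ∈ R, σ x ∈ L) = (x ∈ L, x ∈ R) :=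
    Equiv.ofFiberEquiv_map (f := f) (g := g) fun c => (hfibre c).some
  exact ⟨σ, by ext x; exact iff_of_eq (congrArg Prod.fst (hσ x)),
    by ext x; exact iff_of_eq (congrArg Prod.snd (hσ x))⟩

theorem exists_affineEquiv_of_map_add (σ : Equiv.Perm M)
    (h : ∀ x y, σ (x + y) + σ 0 = σ x + σ y) : ∃ a : M ≃ᵃ[ℤ] M, ⇑a = σ := by
  let f : M ≃+ M :=
    { σ.trans (Equiv.subRight (σ 0)) with
      map_add' := fun x y => by
        change σ (x + y) - σ 0 = σ x - σ 0 + (σ y - σ 0)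
        rw [eq_sub_of_add_eq (h x y)]
        abel }
  exact ⟨AffineEquiv.mk' σ f.toIntLinearEquiv 0 fun x => by simp [f], rfl⟩

theorem HasAffineSymmetries.of_perm_map_add [Finite M]
    (h : ∀ σ : Equiv.Perm M, ∀ x y, σ (x + y) + σ 0 = σ x + σ y) : HasAffineSymmetries M := by
  intro R L hRL
  obtain ⟨σ, hσ⟩ := exists_perm_exchanging hRL
  obtain ⟨a, ha⟩ := exists_affineEquiv_of_map_add σ (h σ)
  exact ⟨a, Or.inr (ha ▸ hσ)⟩

theorem hasAffineSymmetries_zmod_one : HasAffineSymmetries (ZMod 1) :=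
  .of_perm_map_add (by decide)

theorem hasAffineSymmetries_zmod_two : HasAffineSymmetries (ZMod 2) :=
  .of_perm_map_add (by decide)

theorem hasAffineSymmetries_zmod_three : HasAffineSymmetries (ZMod 3) :=
  .of_perm_map_add (by decide)

theorem hasAffineSymmetries_klein : HasAffineSymmetries (ZMod 2 × ZMod 2) :=
  .of_perm_map_add (by decide +kernel)

end Small

section Cube

/-- The elementary abelian group of order eight, written additively. -/
abbrev Cube := ZMod 2 × ZMod 2 × ZMod 2

/-- The standard bilinear form on the cube. -/
def dot (u x : Cube) : ZMod 2 := u.1 * x.1 + u.2.1 * x.2.1 + u.2.2 * x.2.2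

/-- The transvection with axis `u` and direction `p`, followed by the translation by `b`. It is an
involution if `p` and `b` are orthogonal to `u`. -/
def affineTransvection (u p b x : Cube) : Cube := x + dot u x • p + b

/-- The first vector of the standard basis. -/
def e₁ : Cube := (1, 0, 0)

/-- The second vector of the standard basis. -/
def e₂ : Cube := (0, 1, 0)

/-- The third vector of the standard basis. -/
def e₃ : Cube := (0, 0, 1)

/-- An enumeration of the cube, listing its subsets as sublists. -/
def cubePoints : List Cube := [0, e₁, e₂, e₃, e₁ + e₂, e₁ + e₃, e₂ + e₃, e₁ + e₂ + e₃]

/-- The nonempty sets of at most four points up to affine equivalence: the initial segments of a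
frame, and a plane. -/
def cubeNormalForms : List (List Cube) :=
  [[0], [0, e₁], [0, e₁, e₂], [0, e₁, e₂, e₁ + e₂], [0, e₁, e₂, e₃]]

theorem dot_add (u x y : Cube) : dot u (x + y) = dot u x + dot u y := by
  simp only [dot, Prod.fst_add, Prod.snd_add]
  ring

theorem dot_smul (u : Cube) (c : ZMod 2) (x : Cube) : dot u (c • x) = c * dot u x := by
  simp only [dot, Prod.smul_fst, Prod.smul_snd, smul_eq_mul]
  ring

theorem affineTransvection_involutive {u p b : Cube} (hp : dot u p = 0) (hb : dot u b = 0) :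
    Function.Involutive (affineTransvection u p b) := by
  intro x
  have htwo : ∀ y : Cube, y + y = 0 := by decide
  simp only [affineTransvection, dot_add, dot_smul, hp, hb, mul_zero, add_zero]
  linear_combination (exp := 1) htwo (dot u x • p) + htwo b

theorem exists_affineEquiv_transvection {u p b : Cube} (hp : dot u p = 0) (hb : dot u b = 0) :
    ∃ a : Cube ≃ᵃ[ℤ] Cube, ⇑a = affineTransvection u p b := by
  refine exists_affineEquiv_of_map_add (affineTransvection_involutive hp hb).toPerm fun x y => ?_
  have hzero : dot u 0 = 0 := by simp [dot]
  simp only [Function.Involutive.coe_toPerm, affineTransvection, dot_add, hzero]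
  module

theorem frame_linearIndependent : ∀ v₁ v₂ v₃ : Cube, v₁ ≠ 0 → v₂ ∉ ({0, v₁} : Finset Cube) →
    v₃ ∉ ({0, v₁, v₂, v₁ + v₂} : Finset Cube) →
    ∀ x : Cube, x.1 • v₁ + x.2.1 • v₂ + x.2.2 • v₃ = 0 → x = 0 := by
  decide +kernel

theorem exists_affineEquiv_frame {r₀ r₁ r₂ r₃ : Cube} (h₁ : r₁ ≠ r₀)
    (h₂ : r₂ ∉ ({r₀, r₁} : Finset Cube)) (h₃ : r₃ ∉ ({r₀, r₁, r₂, r₁ + r₂ - r₀} : Finset Cube)) :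
    ∃ e : Cube ≃ᵃ[ℤ] Cube, e 0 = r₀ ∧ e e₁ = r₁ ∧ e e₂ = r₂ ∧ e e₃ = r₃ ∧
      e (e₁ + e₂) = r₁ + r₂ - r₀ := by
  let f : Cube → Cube := fun x =>
    x.1 • (r₁ - r₀) + x.2.1 • (r₂ - r₀) + x.2.2 • (r₃ - r₀) + r₀
  have hinj : Function.Injective f := by
    intro x y hxy
    refine sub_eq_zero.1 (frame_linearIndependent (r₁ - r₀) (r₂ - r₀) (r₃ - r₀) ?_ ?_ ?_ _ ?_)
    · exact sub_ne_zero.2 h₁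
    · simpa [sub_eq_zero] using h₂
    · have hplane : r₃ - r₀ = r₁ - r₀ + (r₂ - r₀) ↔ r₃ = r₁ + r₂ - r₀ := by
        rw [sub_eq_iff_eq_add]
        abel_nf
      simpa [sub_eq_zero, hplane] using h₃
    · have hsub : f x - f y = 0 := sub_eq_zero.2 hxy
      rw [← hsub]
      simp only [f, Prod.fst_sub, Prod.snd_sub]
      module
  obtain ⟨e, he⟩ := exists_affineEquiv_of_map_add
    (Equiv.ofBijective f (Finite.injective_iff_bijective.1 hinj)) fun x y => by
      simp only [Equiv.ofBijective_apply, f, Prod.fst_add, Prod.snd_add, Prod.fst_zero,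
        Prod.snd_zero]
      module
  refine ⟨e, ?_⟩
  simp only [he, Equiv.ofBijective_apply, f, e₁, e₂, e₃]
  simp only [Prod.fst_zero, Prod.snd_zero, Prod.mk_add_mk, add_zero, zero_add, zero_smul, one_smul,
    sub_add_cancel, true_and]
  abel

theorem exists_cubeNormalForm {R : Set Cube} (hR : R.Nonempty) (hcard : R.ncard ≤ 4) :
    ∃ N ∈ cubeNormalForms, ∃ e : Cube ≃ᵃ[ℤ] Cube, R = e '' {x | x ∈ N} := by
  have hnew : ∀ s : Finset Cube, s.card ≤ 4 → ∃ x, x ∉ s := fun s hs => by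
    by_contra! h
    simp [Finset.eq_univ_of_forall h] at hs
  have hext (r₀ r₁ r₂ : Cube) : ∃ r₃, r₃ ∉ ({r₀, r₁, r₂, r₁ + r₂ - r₀} : Finset Cube) :=
    hnew _ Finset.card_le_four
  have hpos : 0 < R.ncard := (Set.ncard_pos R.toFinite).2 hR
  obtain h | h | h | h : R.ncard = 1 ∨ R.ncard = 2 ∨ R.ncard = 3 ∨ R.ncard = 4 := by omega
  · obtain ⟨r₀, rfl⟩ := Set.ncard_eq_one.1 h
    exact ⟨[0], by decide, AffineEquiv.constVAdd ℤ Cube r₀, by simp⟩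
  · obtain ⟨r₀, r₁, h₁, rfl⟩ := Set.ncard_eq_two.1 h
    obtain ⟨r₂, h₂⟩ := hnew {r₀, r₁} (Finset.card_le_two.trans (by norm_num))
    obtain ⟨r₃, h₃⟩ := hext r₀ r₁ r₂
    obtain ⟨e, he⟩ := exists_affineEquiv_frame h₁.symm h₂ h₃
    exact ⟨[0, e₁], by decide, e, by grind⟩
  · obtain ⟨r₀, r₁, r₂, h₁, h₂, h₂', rfl⟩ := Set.ncard_eq_three.1 h
    obtain ⟨r₃, h₃⟩ := hext r₀ r₁ r₂
    obtain ⟨e, he⟩ := exists_affineEquiv_frame h₁.symm (by simp [h₂.symm, h₂'.symm]) h₃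
    exact ⟨[0, e₁, e₂], by decide, e, by grind⟩
  · obtain ⟨r₀, r₁, r₂, r₃, h₁, h₂, h₃, h₂', h₃', h₃'', rfl⟩ := Set.ncard_eq_four.1 h
    have hr₂ : r₂ ∉ ({r₀, r₁} : Finset Cube) := by simp [h₂.symm, h₂'.symm]
    by_cases hr₃ : r₃ = r₁ + r₂ - r₀
    · obtain ⟨s, hs⟩ := hext r₀ r₁ r₂
      obtain ⟨e, he⟩ := exists_affineEquiv_frame h₁.symm hr₂ hs
      exact ⟨[0, e₁, e₂, e₁ + e₂], by decide, e, by grind⟩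
    · obtain ⟨e, he⟩ := exists_affineEquiv_frame h₁.symm hr₂ (r₃ := r₃)
        (by simp [h₃.symm, h₃'.symm, h₃''.symm, hr₃])
      exact ⟨[0, e₁, e₂, e₃], by decide, e, by grind⟩

set_option maxRecDepth 100000 in
set_option synthInstance.maxSize 2000 in
set_option synthInstance.maxHeartbeats 200000 in
-- The nested quantifiers over lists make the `Decidable` instance large.
theorem exists_transvection_cubeNormalForm :
    ∀ N ∈ cubeNormalForms, ∀ L ∈ cubePoints.sublistsLen N.length,
    (∃ b ∈ N, ∃ u, dot u b = 0 ∧ ∃ p, dot u p = 0 ∧ (∀ x ∈ N, affineTransvection u p b x ∈ N) ∧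
      (∀ x ∈ L, affineTransvection u p b x ∈ L) ∧ ∃ x, affineTransvection u p b x ≠ x) ∨
    (∃ b ∈ L, ∃ u, dot u b = 0 ∧ ∃ p, dot u p = 0 ∧ (∀ x ∈ N, affineTransvection u p b x ∈ L) ∧
      ∀ x ∈ L, affineTransvection u p b x ∈ N) := by
  decide +kernel

theorem affinelySymmetric_cubeNormalForm {N : List Cube} (hN : N ∈ cubeNormalForms) {L : Set Cube}
    (hL : L.ncard = N.length) : AffinelySymmetric {x | x ∈ N} L := by
  classical
  let l := cubePoints.filter (· ∈ L)
  have hmem : ∀ x, x ∈ l ↔ x ∈ L := fun x => by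
    have hall : ∀ x, x ∈ cubePoints := by decide
    simp [l, hall]
  have hl : l ∈ cubePoints.sublistsLen N.length := by
    have hnodup : l.Nodup := List.Nodup.filter _ (by decide)
    refine List.mem_sublistsLen.2 ⟨List.filter_sublist, ?_⟩
    rw [← List.toFinset_card_of_nodup hnodup, ← hL, ← Set.ncard_coe_finset, List.coe_toFinset]
    simp only [hmem, Set.ofPred_mem_eq]
  rw [← show {x | x ∈ l} = L from Set.ext hmem]
  have hpre {u p b : Cube} (hp : dot u p = 0) (hb : dot u b = 0) {X Y : List Cube}
      (hXY : ∀ x ∈ X, affineTransvection u p b x ∈ Y)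
      (hYX : ∀ x ∈ Y, affineTransvection u p b x ∈ X) :
      affineTransvection u p b ⁻¹' {x | x ∈ Y} = {x | x ∈ X} := by
    refine Set.Subset.antisymm (fun x hx => ?_) hXY
    have := hYX _ hx
    rwa [affineTransvection_involutive hp hb x] at this
  obtain ⟨b, -, u, hb, p, hp, hNN, hLL, x, hx⟩ | ⟨b, -, u, hb, p, hp, hNL, hLN⟩ :=
    exists_transvection_cubeNormalForm N hN l hl <;>
    obtain ⟨a, ha⟩ := exists_affineEquiv_transvection hp hb
  · refine ⟨a, Or.inl ⟨?_, ?_, ?_⟩⟩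
    · rintro rfl
      exact hx (congrFun ha x).symm
    · rw [ha, hpre hp hb hNN hNN]
    · rw [ha, hpre hp hb hLL hLL]
  · exact ⟨a, Or.inr ⟨by rw [ha, hpre hp hb hLN hNL], by rw [ha, hpre hp hb hNL hLN]⟩⟩

theorem affinelySymmetric_of_ncard_le_four {R L : Set Cube} (hRL : R.ncard = L.ncard)
    (hR : R.ncard ≤ 4) : AffinelySymmetric R L := by
  obtain rfl | hne := R.eq_empty_or_nonempty
  · obtain rfl : L = ∅ := (Set.ncard_eq_zero L.toFinite).1 (by simpa using hRL.symm)
    exact ⟨1, Or.inr ⟨rfl, rfl⟩⟩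
  obtain ⟨N, hN, e, rfl⟩ := exists_cubeNormalForm hne hR
  have hnodup : ∀ N ∈ cubeNormalForms, N.Nodup := by decide
  rw [← Set.image_preimage_eq L e.surjective]
  refine (affinelySymmetric_cubeNormalForm hN ?_).image e
  rw [Set.ncard_def, Set.encard_preimage_of_bijective e.bijective, ← Set.ncard_def, ← hRL,
    Set.ncard_image_of_injective _ e.injective, ← List.coe_toFinset, Set.ncard_coe_finset,
    List.toFinset_card_of_nodup (hnodup N hN)]

theorem hasAffineSymmetries_cube : HasAffineSymmetries Cube := by
  intro R L hRL
  have hncard : R.ncard = L.ncard := congrArg ENat.toNat hRL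
  by_cases hR : R.ncard ≤ 4
  · exact affinelySymmetric_of_ncard_le_four hncard hR
  · have hcube : Nat.card Cube = 8 := by simp
    have hRc := Set.ncard_add_ncard_compl R
    have hLc := Set.ncard_add_ncard_compl L
    exact (affinelySymmetric_of_ncard_le_four (by omega) (by omega)).of_compl

end Cube

section NoHaarRepresentation

variable {M : Type*} [AddCommGroup M] {R L : Set M} {a : M ≃ᵃ[ℤ] M}

/-- The connection sets of the Haar digraph on `M` with arcs `(x, false) → (y, true)` for
`-x + y ∈ R` and `(y, true) → (x, false)` for `-x + y ∈ L`. With this sign convention for `L`, an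
affine map `a` acting as `a` on the second side and as its linear part on the first one transforms
`R` and `L` in the same way. -/
def differenceConnection (R L : Set M) : Bool → Bool → Set (Multiplicative M) :=
  haarConnection (Multiplicative.toAdd ⁻¹' R) (Multiplicative.toAdd ⁻¹' (-L))

theorem sub_linear_mem_iff {X Y : Set M} (h : a ⁻¹' X = Y) (x y : M) :
    -a.linear x + a y ∈ X ↔ -x + y ∈ Y := by
  rw [← h, Set.mem_preimage, ← map_neg, ← vadd_eq_add, ← a.map_vadd, vadd_eq_add]

theorem linear_sub_mem_neg_iff {X Y : Set M} (h : a ⁻¹' X = Y) (x y : M) :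
    -a y + a.linear x ∈ -X ↔ -y + x ∈ -Y := by
  simpa only [Set.mem_neg, neg_add_rev, neg_neg] using sub_linear_mem_iff h x y

theorem not_isPartiteConnection_of_preserves (ha : a ≠ 1) (hR : a ⁻¹' R = R) (hL : a ⁻¹' L = L) :
    ¬ IsPartiteConnection (differenceConnection R L) := by
  intro hS
  let σ : Equiv.Perm (Multiplicative M × Bool) := Equiv.prodCongrLeft fun b =>
    Multiplicative.ofAdd.permCongr (bif b then a.toEquiv else a.linear.toEquiv)
  have hσ : σ ∈ (multiCayley (differenceConnection R L)).autGroup := by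
    rintro ⟨x, _ | _⟩ ⟨y, _ | _⟩
    · rfl
    · exact sub_linear_mem_iff hR x.toAdd y.toAdd
    · exact linear_sub_mem_neg_iff hL y.toAdd x.toAdd
    · rfl
  obtain ⟨t, ht⟩ := hS.rigid σ hσ
  have h0 : a.linear 0 = t.toAdd + 0 := congrArg Prod.fst (ht (1, false))
  obtain rfl : t = 1 := by simpa using h0.symm
  refine ha (AffineEquiv.ext fun x => ?_)
  exact (congrArg Prod.fst (ht (Multiplicative.ofAdd x, true))).trans (one_mul _)

theorem not_isPartiteConnection_of_exchanges (hR : a ⁻¹' R = L) (hL : a ⁻¹' L = R) :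
    ¬ IsPartiteConnection (differenceConnection R L) := by
  intro hS
  let σ : Equiv.Perm (Multiplicative M × Bool) := (Equiv.prodCongrLeft fun b =>
    Multiplicative.ofAdd.permCongr
      ((bif b then a.toEquiv else a.linear.toEquiv).trans (Equiv.neg M))).trans
    ((Equiv.refl _).prodCongr Equiv.boolNot)
  have hσ : σ ∈ (multiCayley (differenceConnection R L)).autGroup := by
    rintro ⟨x, _ | _⟩ ⟨y, _ | _⟩
    · rfl
    · change -(-a.linear x.toAdd) + -a y.toAdd ∈ -L ↔ -x.toAdd + y.toAdd ∈ R
      rw [← sub_linear_mem_iff hL, Set.mem_neg, neg_add, neg_neg, neg_neg]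
    · change -(-a x.toAdd) + -a.linear y.toAdd ∈ R ↔ -x.toAdd + y.toAdd ∈ -L
      rw [← linear_sub_mem_neg_iff hR, Set.mem_neg, neg_add, neg_neg]
    · rfl
  obtain ⟨t, ht⟩ := hS.rigid σ hσ
  have hside : true = false := congrArg Prod.snd (ht (1, false))
  contradiction

theorem AffinelySymmetric.not_isPartiteConnection (h : AffinelySymmetric R L) :
    ¬ IsPartiteConnection (differenceConnection R L) := by
  obtain ⟨a, ⟨ha, hR, hL⟩ | ⟨hR, hL⟩⟩ := h
  · exact not_isPartiteConnection_of_preserves ha hR hL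
  · exact not_isPartiteConnection_of_exchanges hR hL

theorem eq_haarConnection {S : Bool → Bool → Set V} (hS : ∀ i, S i i = ∅) :
    S = haarConnection (S false true) (S true false) := by
  funext i j
  cases i <;> cases j <;> simp [haarConnection, hS]

theorem HasAffineSymmetries.not_isPartiteConnection (h : HasAffineSymmetries M)
    {S : Bool → Bool → Set (Multiplicative M)} : ¬ IsPartiteConnection S := by
  intro hS
  have hS_eq : S = differenceConnection (Multiplicative.ofAdd ⁻¹' S false true)
      (-(Multiplicative.ofAdd ⁻¹' S true false)) := by
    rw [eq_haarConnection hS.diag_eq_empty, differenceConnection, neg_neg]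
    rfl
  have hcard : (S false true).encard = (S true false).encard :=
    (isRegular_haarConnection_iff.1 (eq_haarConnection hS.diag_eq_empty ▸ hS.regular)).2
  refine (h _ _ ?_).not_isPartiteConnection (hS_eq ▸ hS)
  rw [Set.encard_preimage_of_bijective Multiplicative.ofAdd.bijective, hcard,
    ← Set.image_neg_eq_neg, neg_injective.encard_image,
    Set.encard_preimage_of_bijective Multiplicative.ofAdd.bijective]

theorem AdmitsPartiteRepresentation.of_mulEquiv {H : Type*} [Group H] {n : ℕ}
    (h : AdmitsPartiteRepresentation.{_, v} G n) (e : G ≃* H) :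
    AdmitsPartiteRepresentation.{_, v} H n := by
  obtain ⟨V, hV, Γ, hΓ⟩ := h
  exact ⟨V, hV, Γ, { hΓ with aut_iso := hΓ.aut_iso.map (·.trans e) }⟩

theorem HasAffineSymmetries.not_admits_two [Finite M] (h : HasAffineSymmetries M)
    (e : G ≃* Multiplicative M) : ¬ AdmitsPartiteRepresentation.{_, v} G 2 := by
  intro hG
  have hM : AdmitsPartiteRepresentation.{_, v} (Multiplicative M) (Nat.card Bool) := by
    simpa using hG.of_mulEquiv e
  obtain ⟨S, hS⟩ := admitsPartiteRepresentation_iff.1 hM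
  exact h.not_isPartiteConnection hS

end NoHaarRepresentation

section Factorization

/-- Every vertex has exactly `d` out-neighbours and `d` in-neighbours. -/
def HasValency (Γ : Digraph V) (d : ℕ) : Prop :=
  ∀ x, {y | Γ.Adj x y}.encard = d ∧ {y | Γ.Adj y x}.encard = d

/-- The union of the functional digraphs of a family of permutations. -/
def permDigraph (σ : I → Equiv.Perm V) : Digraph V where
  Adj x y := ∃ i, σ i x = y

theorem HasValency.exists_perm [Finite V] {Γ : Digraph V} {d : ℕ} (hΓ : HasValency Γ d)
    (hd : 0 < d) : ∃ σ : Equiv.Perm V, ∀ x, Γ.Adj x (σ x) := by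
  classical
  have := Fintype.ofFinite V
  have hcard : ∀ {p : V → Prop}, {x | p x}.encard = d → (Finset.univ.filter p).card = d := by
    intro p hp
    rw [← Nat.cast_inj (R := ℕ∞), ← hp, ← Set.encard_coe_eq_coe_finsetCard, Finset.coe_filter_univ]
  have hhall : ∀ A : Finset V, A.card ≤ (Finset.univ.filter fun y => ∃ x ∈ A, Γ.Adj x y).card := by
    intro A
    refine Nat.le_of_mul_le_mul_right (Finset.card_mul_le_card_mul Γ.Adj (fun x hx => ?_)
      fun y _ => ?_) hd
    · rw [← hcard (hΓ x).1]
      refine Finset.card_le_card fun y hy => ?_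
      simp only [Finset.mem_filter_univ] at hy
      simpa [Finset.mem_bipartiteAbove] using ⟨⟨x, hx, hy⟩, hy⟩
    · rw [← hcard (hΓ y).2]
      exact Finset.card_le_card (Finset.filter_subset_filter _ (Finset.subset_univ A))
  obtain ⟨f, hf, hadj⟩ := (Fintype.all_card_le_filter_rel_iff_exists_injective Γ.Adj).1 hhall
  exact ⟨Equiv.ofBijective f (Finite.injective_iff_bijective.1 hf), hadj⟩

theorem HasValency.erase_perm {Γ : Digraph V} {d : ℕ} (hΓ : HasValency Γ (d + 1))
    {σ : Equiv.Perm V} (hσ : ∀ x, Γ.Adj x (σ x)) :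
    HasValency ⟨fun x y => Γ.Adj x y ∧ σ x ≠ y⟩ d := by
  refine fun x => ⟨?_, ?_⟩
  · have hdiff : {y | Γ.Adj x y ∧ σ x ≠ y} = {y | Γ.Adj x y} \ {σ x} := by
      ext y
      simp [eq_comm]
    rw [hdiff, Set.encard_sdiff_singleton_of_mem (by exact hσ x), (hΓ x).1]
    rfl
  · have hdiff : {y | Γ.Adj y x ∧ σ y ≠ x} = {y | Γ.Adj y x} \ {σ.symm x} := by
      ext y
      simp [Equiv.eq_symm_apply]
    have hmem : Γ.Adj (σ.symm x) x := by simpa using hσ (σ.symm x)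
    rw [hdiff, Set.encard_sdiff_singleton_of_mem (by exact hmem), (hΓ x).2]
    rfl

theorem HasValency.exists_factorization [Finite V] {Γ : Digraph V} {d : ℕ} (hΓ : HasValency Γ d) :
    ∃ σ : Fin d → Equiv.Perm V, Γ = permDigraph σ ∧ ∀ x, Function.Injective fun i => σ i x := by
  induction d generalizing Γ with
  | zero =>
    refine ⟨Fin.elim0, Digraph.ext ?_, fun _ => Function.injective_of_subsingleton _⟩
    funext x y
    have hempty : {y | Γ.Adj x y} = ∅ := Set.encard_eq_zero.1 (hΓ x).1
    simpa [permDigraph] using Set.eq_empty_iff_forall_notMem.1 hempty y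
  | succ d ih =>
    obtain ⟨σ, hσ⟩ := hΓ.exists_perm d.succ_pos
    obtain ⟨τ, hτ, hinj⟩ := ih (hΓ.erase_perm hσ)
    have hadj : ∀ x y, (Γ.Adj x y ∧ σ x ≠ y) ↔ ∃ i, τ i x = y := fun x y =>
      iff_of_eq (congrArg (fun Δ : Digraph V => Δ.Adj x y) hτ)
    refine ⟨Fin.cons σ τ, Digraph.ext ?_, fun x => ?_⟩
    · funext x y
      simp only [permDigraph, Fin.exists_fin_succ, Fin.cons_zero, Fin.cons_succ, ← hadj, eq_iff_iff]
      by_cases hxy : σ x = y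
      · simp [← hxy, hσ]
      · simp [hxy]
    · have hcons : (fun i => (Fin.cons σ τ : Fin (d + 1) → Equiv.Perm V) i x) =
          Fin.cons (σ x) fun i => τ i x := by
        funext i
        cases i using Fin.cases <;> rfl
      rw [hcons, Fin.cons_injective_iff]
      refine ⟨?_, hinj x⟩
      rintro ⟨i, hi⟩
      exact ((hadj x _).2 ⟨i, hi⟩).2 rfl

end Factorization

section SmallDigraphs

theorem exists_ne_one_mem_autGroup_of_equiv {Γ : Digraph V} {Δ : Digraph W} (e : V ≃ W)
    (he : ∀ x y, Δ.Adj (e x) (e y) ↔ Γ.Adj x y) (h : ∃ σ ∈ Δ.autGroup, σ ≠ 1) :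
    ∃ σ ∈ Γ.autGroup, σ ≠ 1 := by
  obtain ⟨σ, hσ, hne⟩ := h
  obtain ⟨τ, rfl⟩ := e.permCongr.surjective σ
  refine ⟨τ, (permCongr_mem_autGroup_iff e he).1 hσ, ?_⟩
  rintro rfl
  exact hne (Equiv.ext fun x => by simp)

theorem exists_conj_eq_normalForm : ∀ σ : Equiv.Perm (Fin 5), (∀ x, σ x ≠ x) →
    ∃ ρ : Equiv.Perm (Fin 5), ρ * σ * ρ⁻¹ ∈ [finRotate 5, c[0, 1] * c[2, 3, 4]] := by
  decide +kernel

theorem exists_ne_one_mem_autGroup_normalForm :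
    ∀ σ ∈ [finRotate 5, c[0, 1] * c[2, 3, 4]], ∀ τ : Equiv.Perm (Fin 5),
    (∀ x, τ x ≠ x) → (∀ x, σ x ≠ τ x) → ∃ α : Equiv.Perm (Fin 5),
      (∀ x y, (σ (α x) = α y ∨ τ (α x) = α y) ↔ (σ x = y ∨ τ x = y)) ∧ α ≠ 1 := by
  decide +kernel

theorem exists_ne_one_mem_autGroup_of_valency_two (hV : Nat.card V = 5)
    {σ : Fin 2 → Equiv.Perm V} (hloop : ∀ x, ¬ (permDigraph σ).Adj x x)
    (hσ : ∀ x, Function.Injective fun i => σ i x) : ∃ α ∈ (permDigraph σ).autGroup, α ≠ 1 := by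
  have hfix : ∀ i x, σ i x ≠ x := fun i x h => hloop x ⟨i, h⟩
  have : Finite V := Nat.finite_of_card_ne_zero (by omega)
  let e : V ≃ Fin 5 := Finite.equivFinOfCardEq hV
  obtain ⟨ρ, hρ⟩ := exists_conj_eq_normalForm (e.permCongr (σ 0)) fun x => by
    simpa [← Equiv.eq_symm_apply] using hfix 0 (e.symm x)
  let σ' : Fin 2 → Equiv.Perm (Fin 5) := fun i => (e.trans ρ).permCongr (σ i)
  refine exists_ne_one_mem_autGroup_of_equiv (Δ := permDigraph σ') (e.trans ρ)
    (fun x y => by simp [permDigraph, σ']) ?_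
  have hfix' : ∀ x, σ' 1 x ≠ x := fun x => by
    simpa [σ', ← Equiv.eq_symm_apply] using hfix 1 ((e.trans ρ).symm x)
  have hne' : ∀ x, σ' 0 x ≠ σ' 1 x := fun x h => zero_ne_one (hσ _ ((e.trans ρ).injective h))
  obtain ⟨α, hα, hne⟩ := exists_ne_one_mem_autGroup_normalForm (σ' 0) hρ (σ' 1) hfix' hne'
  exact ⟨α, fun x y => by simpa [permDigraph] using hα x y, hne⟩

theorem exists_ne_one_mem_autGroup_of_valency_le_one [Finite V] [Nontrivial V] {Γ : Digraph V}
    (hloop : ∀ x, ¬ Γ.Adj x x) {d : ℕ} (hd : d ≤ 1) (hΓ : HasValency Γ d) :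
    ∃ σ ∈ Γ.autGroup, σ ≠ 1 := by
  classical
  obtain ⟨x, y, hxy⟩ := exists_pair_ne V
  obtain ⟨σ, rfl, -⟩ := hΓ.exists_factorization
  obtain rfl | rfl := Nat.le_one_iff_eq_zero_or_eq_one.1 hd
  · exact ⟨Equiv.swap x y, fun _ _ => by simp [permDigraph],
      by simpa [Equiv.Perm.one_def] using hxy⟩
  · refine ⟨σ 0, fun x y => by simp [permDigraph], fun h => hloop x ⟨0, ?_⟩⟩
    rw [h, Equiv.Perm.one_apply]

/-- The complement of a digraph among the loopless digraphs. -/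
def looplessCompl (Γ : Digraph V) : Digraph V where
  Adj x y := x ≠ y ∧ ¬ Γ.Adj x y

theorem autGroup_looplessCompl {Γ : Digraph V} (hloop : ∀ x, ¬ Γ.Adj x x) :
    (looplessCompl Γ).autGroup = Γ.autGroup := by
  ext σ
  refine forall₂_congr fun x y => ?_
  obtain rfl | hxy := eq_or_ne x y
  · simp [looplessCompl, hloop]
  · simp [looplessCompl, hxy, not_iff_not]

theorem HasValency.compl [Finite V] {Γ : Digraph V} (hloop : ∀ x, ¬ Γ.Adj x x) {d : ℕ}
    (hΓ : HasValency Γ d) : HasValency (looplessCompl Γ) (Nat.card V - 1 - d) := by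
  have hcompl : ∀ {s : Set V} {x : V}, x ∉ s → s.encard = d →
      (insert x s)ᶜ.encard = (Nat.card V - 1 - d : ℕ) := by
    intro s x hx hs
    have hcard := Set.encard_add_encard_compl (insert x s)
    rw [Set.encard_insert_of_notMem hx, hs, Set.encard_univ, ENat.card_eq_coe_natCard,
      ← (Set.toFinite _).cast_ncard_eq] at hcard
    rw [← (Set.toFinite _).cast_ncard_eq]
    norm_cast at hcard ⊢
    omega
  refine fun x => ⟨?_, ?_⟩
  · rw [← hcompl (s := {y | Γ.Adj x y}) (hloop x) (hΓ x).1]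
    congr 1
    ext y
    simp [looplessCompl, eq_comm]
  · rw [← hcompl (s := {y | Γ.Adj y x}) (hloop x) (hΓ x).2]
    congr 1
    ext y
    simp [looplessCompl]

theorem exists_ne_one_mem_autGroup [Nontrivial V] [Finite V] (hV : Nat.card V ≤ 5) {Γ : Digraph V}
    (hloop : ∀ x, ¬ Γ.Adj x x) (hΓ : Γ.IsRegular) : ∃ σ ∈ Γ.autGroup, σ ≠ 1 := by
  obtain ⟨d, hd : HasValency Γ d⟩ := hΓ
  by_cases hd1 : d ≤ 1
  · exact exists_ne_one_mem_autGroup_of_valency_le_one hloop hd1 hd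
  by_cases hd2 : Nat.card V - 1 - d ≤ 1
  · rw [← autGroup_looplessCompl hloop]
    exact exists_ne_one_mem_autGroup_of_valency_le_one (by simp [looplessCompl]) hd2
      (hd.compl hloop)
  obtain ⟨hV5, rfl⟩ : Nat.card V = 5 ∧ d = 2 := by omega
  obtain ⟨σ, rfl, hσ⟩ := hd.exists_factorization
  exact exists_ne_one_mem_autGroup_of_valency_two hV5 hloop hσ

end SmallDigraphs

section TrivialGroup

theorem isPartiteConnection_of_asymmetric [Subsingleton G] {Γ : Digraph I} (hreg : Γ.IsRegular)
    (hloop : ∀ i, ¬ Γ.Adj i i) (hasymm : Γ.autGroup = ⊥) :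
    IsPartiteConnection fun i j => {_c : G | Γ.Adj i j} := by
  let := uniqueOfSubsingleton (1 : G)
  let e : G × I ≃ I := Equiv.uniqueProd I G
  have he : ∀ x y, Γ.Adj (e x) (e y) ↔
      (multiCayley fun i j => {_c : G | Γ.Adj i j}).Adj x y := fun _ _ => Iff.rfl
  refine ⟨(isRegular_iff_of_equiv e he).2 hreg, fun i => by simp [hloop], fun σ hσ => ⟨1, ?_⟩⟩
  rw [← permCongr_mem_autGroup_iff e he, hasymm, Subgroup.mem_bot] at hσ
  intro x
  rw [e.permCongr.injective (hσ.trans (e.permCongr_refl).symm)]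
  simp

theorem admits_of_asymmetric {G : Type u} [Group G] [Subsingleton G] [Finite I] [Nonempty I]
    {Γ : Digraph I} (hreg : Γ.IsRegular) (hloop : ∀ i, ¬ Γ.Adj i i) (hasymm : Γ.autGroup = ⊥) :
    AdmitsPartiteRepresentation.{u, v} G (Nat.card I) :=
  (isPartiteConnection_of_asymmetric hreg hloop hasymm).admits

theorem not_admits_of_subsingleton {G : Type u} [Group G] [Subsingleton G] {n : ℕ} (hn : 2 ≤ n)
    (hn5 : n ≤ 5) : ¬ AdmitsPartiteRepresentation.{u, v} G n := by
  have : Nontrivial (Fin n) := Fin.nontrivial_iff_two_le.2 hn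
  rw [← Nat.card_fin n, admitsPartiteRepresentation_iff]
  rintro ⟨S, hS⟩
  have hcard : Nat.card (G × Fin n) ≤ 5 := by simpa [Nat.card_unique] using hn5
  obtain ⟨σ, hσ, hne⟩ := exists_ne_one_mem_autGroup hcard
    (fun x => by simp [multiCayley_adj, hS.diag_eq_empty]) hS.regular
  obtain ⟨t, ht⟩ := hS.rigid σ hσ
  exact hne (Equiv.ext fun x => by rw [ht]; exact Prod.ext (Subsingleton.elim _ _) rfl)

/-- A regular digraph of valency two on six vertices whose automorphism group is trivial. -/
def sixDigraph : Digraph (Fin 6) where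
  Adj i j := j ∈ (![{1, 2}, {0, 2}, {3, 4}, {4, 5}, {1, 5}, {0, 3}] : Fin 6 → Finset (Fin 6)) i

instance : DecidableRel sixDigraph.Adj := fun _ _ =>
  inferInstanceAs (Decidable (_ ∈ (_ : Finset (Fin 6))))

theorem isRegular_sixDigraph : sixDigraph.IsRegular := by
  refine ⟨2, fun x => ⟨?_, ?_⟩⟩ <;>
  · rw [Set.encard_eq_coe_toFinset_card, Nat.cast_inj]
    decide +revert

theorem autGroup_sixDigraph : sixDigraph.autGroup = ⊥ := by
  have htrivial : ∀ σ : Equiv.Perm (Fin 6),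
      (∀ x y, sixDigraph.Adj x y → sixDigraph.Adj (σ x) (σ y)) → σ = 1 := by
    decide +kernel
  exact (Subgroup.eq_bot_iff_forall _).2 fun σ hσ => htrivial σ fun x y => (hσ x y).2

/-- A directed cycle on `k + 7` vertices together with backward directed cycles on the first
`k + 4` and on the last three vertices: a regular digraph of valency two whose automorphism group is
trivial. -/
def twoBlockDigraph (k : ℕ) : Digraph (Fin (k + 7)) where
  Adj i j := i.val + 1 = j.val ∨ (i.val = k + 6 ∧ j.val = 0) ∨
    (j.val + 1 = i.val ∧ i.val ≠ k + 4) ∨ (i.val = 0 ∧ j.val = k + 3) ∨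
    (i.val = k + 4 ∧ j.val = k + 6)

variable {k : ℕ} {i j : Fin (k + 7)}

theorem twoBlockDigraph_adj_iff_right :
    (twoBlockDigraph k).Adj i j ↔ j.val = (if i.val = k + 6 then 0 else i.val + 1) ∨
      j.val = if i.val = 0 then k + 3 else if i.val = k + 4 then k + 6 else i.val - 1 := by
  have hi := i.2
  have hj := j.2
  simp only [twoBlockDigraph]
  split_ifs <;> omega

theorem twoBlockDigraph_adj_iff_left :
    (twoBlockDigraph k).Adj i j ↔ i.val = (if j.val = 0 then k + 6 else j.val - 1) ∨
      i.val = if j.val = k + 3 then 0 else if j.val = k + 6 then k + 4 else j.val + 1 := by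
  have hi := i.2
  have hj := j.2
  simp only [twoBlockDigraph]
  split_ifs <;> omega

theorem encard_val_eq_or_eq {n a b : ℕ} (ha : a < n) (hb : b < n) (hab : a ≠ b) :
    {i : Fin n | i.val = a ∨ i.val = b}.encard = 2 := by
  rw [← Set.encard_pair (x := (⟨a, ha⟩ : Fin n)) (y := ⟨b, hb⟩) (by simpa using hab)]
  congr 1
  ext i
  simp [Fin.ext_iff]

theorem isRegular_twoBlockDigraph (k : ℕ) : (twoBlockDigraph k).IsRegular := by
  refine ⟨2, fun i => ⟨?_, ?_⟩⟩
  · simp only [twoBlockDigraph_adj_iff_right]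
    exact encard_val_eq_or_eq (by split_ifs <;> omega) (by split_ifs <;> omega)
      (by split_ifs <;> omega)
  · simp only [twoBlockDigraph_adj_iff_left]
    exact encard_val_eq_or_eq (by split_ifs <;> omega) (by split_ifs <;> omega)
      (by split_ifs <;> omega)

theorem bidirected_twoBlockDigraph : Bidirected (twoBlockDigraph k) i j ↔
    (i.val + 1 = j.val ∧ j.val ≠ k + 4) ∨ (j.val + 1 = i.val ∧ i.val ≠ k + 4) := by
  have hi := i.2
  have hj := j.2
  simp only [Bidirected, twoBlockDigraph]
  omega

/-- The vertex `k + 4` is the only end of a bidirected path of length two that has an arc to the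
other end. -/
theorem apply_eq_self_of_val_eq_add_four {σ : Equiv.Perm (Fin (k + 7))}
    (hσ : σ ∈ (twoBlockDigraph k).autGroup) (hi : i.val = k + 4) : σ i = i := by
  have hunique : ∀ x y z, Bidirected (twoBlockDigraph k) x y → Bidirected (twoBlockDigraph k) y z →
      (twoBlockDigraph k).Adj x z → x.val = k + 4 := by
    intro x y z hxy hyz hxz
    rw [bidirected_twoBlockDigraph] at hxy hyz
    simp only [twoBlockDigraph] at hxz
    omega
  refine Fin.ext ((hunique _ (σ ⟨k + 5, by omega⟩) (σ ⟨k + 6, by omega⟩) ?_ ?_ ?_).trans hi.symm)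
  · rw [bidirected_apply_iff hσ, bidirected_twoBlockDigraph]
    simp [hi]
  · rw [bidirected_apply_iff hσ, bidirected_twoBlockDigraph]
    simp
  · rw [hσ]
    simp [twoBlockDigraph, hi]

theorem apply_eq_self_of_val_lt {σ : Equiv.Perm (Fin (k + 7))}
    (hσ : σ ∈ (twoBlockDigraph k).autGroup) (h0 : ∀ i : Fin (k + 7), i.val = 0 → σ i = i)
    (hi : i.val < k + 4) : σ i = i := by
  obtain ⟨t, ht⟩ : ∃ t, i.val = t := ⟨_, rfl⟩
  induction t using Nat.strong_induction_on generalizing i with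
  | _ t ih =>
    obtain _ | t := t
    · exact h0 i ht
    refine apply_eq_self_of_bidirected hσ
      (ih t (by omega) (i := ⟨t, by omega⟩) (by simp; omega) rfl) ?_
      fun j hj hne => ih j.val ?_ ?_ rfl
    · simp [bidirected_twoBlockDigraph, ht]
      omega
    all_goals
      simp only [bidirected_twoBlockDigraph, ne_eq, Fin.ext_iff] at hj hne
      omega

theorem autGroup_twoBlockDigraph (k : ℕ) : (twoBlockDigraph k).autGroup = ⊥ := by
  refine (Subgroup.eq_bot_iff_forall _).2 fun σ hσ => Equiv.ext fun i => ?_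
  have h4 : ∀ i : Fin (k + 7), i.val = k + 4 → σ i = i := fun i =>
    apply_eq_self_of_val_eq_add_four hσ
  have h5 : ∀ i : Fin (k + 7), i.val = k + 5 → σ i = i := fun i hi => by
    refine apply_eq_self_of_bidirected hσ (h4 ⟨k + 4, by omega⟩ rfl) ?_ fun j hj hne => h4 j ?_
    · simp [bidirected_twoBlockDigraph, hi]
    · simp only [bidirected_twoBlockDigraph, ne_eq, not_true_eq_false, and_false, or_false] at hj
      omega
  have h6 : ∀ i : Fin (k + 7), i.val = k + 6 → σ i = i := fun i hi => by
    refine apply_eq_self_of_bidirected hσ (h5 ⟨k + 5, by omega⟩ rfl) ?_ fun j hj hne => h4 j ?_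
    · simp [bidirected_twoBlockDigraph, hi]
    · simp only [bidirected_twoBlockDigraph, ne_eq, Fin.ext_iff] at hj hne
      omega
  have h0 : ∀ i : Fin (k + 7), i.val = 0 → σ i = i := fun i hi => by
    let l : Fin (k + 7) := ⟨k + 6, by omega⟩
    refine apply_eq_self_of_injective σ.injective (N := {j | (twoBlockDigraph k).Adj l j}) ?_
      fun j hj hne => h5 j ?_
    · have hadj := (hσ l i).2 (Or.inr (Or.inl ⟨rfl, hi⟩))
      rwa [h6 l rfl] at hadj
    · simp only [l, twoBlockDigraph, Set.mem_ofPred_eq, ne_eq, Fin.ext_iff] at hj hne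
      omega
  obtain h | h | h | h : i.val < k + 4 ∨ i.val = k + 4 ∨ i.val = k + 5 ∨ i.val = k + 6 := by omega
  exacts [apply_eq_self_of_val_lt hσ h0 h, h4 i h, h5 i h, h6 i h]

theorem admits_of_six_le {G : Type u} [Group G] [Subsingleton G] {n : ℕ} (hn : 6 ≤ n) :
    AdmitsPartiteRepresentation.{u, v} G n := by
  obtain rfl | hn := hn.eq_or_lt
  · simpa using admits_of_asymmetric.{u, v} (G := G) isRegular_sixDigraph (by decide)
      autGroup_sixDigraph
  · obtain ⟨k, rfl⟩ := Nat.exists_eq_add_of_le' (Nat.succ_le_of_lt hn)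
    simpa using admits_of_asymmetric.{u, v} (G := G) (isRegular_twoBlockDigraph k)
      (fun i => by simp only [twoBlockDigraph]; omega) (autGroup_twoBlockDigraph k)

end TrivialGroup

section OnePart

/-- Counting: left translation embeds `G` into the symmetric group on `G`, of order `|G|!`. -/
theorem forall_perm_eq_mulLeft_iff [Finite G] :
    (∀ σ : Equiv.Perm G, ∃ t, σ = Equiv.mulLeft t) ↔ Nat.card G ≤ 2 := by
  have hinj : Function.Injective (Equiv.mulLeft : G → Equiv.Perm G) := fun s t hst => by
    simpa using DFunLike.congr_fun hst 1
  have hsurj : (∀ σ : Equiv.Perm G, ∃ t, σ = Equiv.mulLeft t) ↔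
      Function.Bijective (Equiv.mulLeft : G → Equiv.Perm G) := by
    simp only [Function.Bijective, hinj, true_and, Function.Surjective, eq_comm]
  rw [hsurj, Nat.bijective_iff_injective_and_card, Nat.card_perm]
  have hpos : 0 < Nat.card G := Nat.card_pos
  constructor
  · rintro ⟨-, h⟩
    by_contra! hG
    exact (Nat.lt_factorial_self hG).ne h
  · intro h
    refine ⟨hinj, ?_⟩
    interval_cases Nat.card G <;> rfl

theorem isPartiteConnection_empty_iff [Finite G] :
    IsPartiteConnection (fun _ _ : Unit => (∅ : Set G)) ↔ Nat.card G ≤ 2 := by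
  rw [← forall_perm_eq_mulLeft_iff]
  let e : G × Unit ≃ G := Equiv.prodPUnit G
  constructor
  · intro h σ
    obtain ⟨t, ht⟩ := h.rigid (e.symm.permCongr σ) fun x y => by simp [multiCayley_adj]
    exact ⟨t, Equiv.ext fun g => by simpa [e, Prod.ext_iff] using ht (g, ())⟩
  · refine fun h => ⟨⟨0, by simp [multiCayley_adj]⟩, fun _ => rfl, fun σ _ => ?_⟩
    obtain ⟨t, ht⟩ := h (e.permCongr σ)
    exact ⟨t, fun x => e.injective (by simpa [e] using DFunLike.congr_fun ht x.1)⟩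

theorem admits_one_iff {G : Type u} [Group G] [Finite G] :
    AdmitsPartiteRepresentation.{u, v} G 1 ↔ Nat.card G ≤ 2 := by
  rw [← isPartiteConnection_empty_iff, ← Nat.card_unique (α := Unit),
    admitsPartiteRepresentation_iff]
  refine ⟨?_, fun h => ⟨_, h⟩⟩
  rintro ⟨S, hS⟩
  obtain rfl : S = fun _ _ => ∅ := funext₂ fun _ j => hS.diag_eq_empty j
  exact hS

end OnePart

theorem theorem1p1 (G : Type u) [Group G] [Finite G] (n : ℕ) (hn : 0 < n) :
    ¬ AdmitsPartiteRepresentation.{u, v} G n ↔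
      (n = 1 ∧ 3 ≤ Nat.card G) ∨
      (n = 2 ∧
        (Nonempty (G ≃* Multiplicative (ZMod 1)) ∨
         Nonempty (G ≃* Multiplicative (ZMod 2)) ∨
         Nonempty (G ≃* Multiplicative (ZMod 3)) ∨
         Nonempty (G ≃* Multiplicative (ZMod 2 × ZMod 2)) ∨
         Nonempty (G ≃* Multiplicative (ZMod 2 × ZMod 2 × ZMod 2)))) ∨
      ((3 ≤ n ∧ n ≤ 5) ∧ Nonempty (G ≃* Multiplicative (ZMod 1))) := by
  have hsub : Nonempty (G ≃* Multiplicative (ZMod 1)) → Subsingleton G := fun ⟨e⟩ =>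
    have : Subsingleton (Multiplicative (ZMod 1)) := inferInstanceAs (Subsingleton (Fin 1))
    e.toEquiv.subsingleton
  constructor
  · intro h
    obtain rfl | rfl | hn3 : n = 1 ∨ n = 2 ∨ 3 ≤ n := by omega
    · exact Or.inl ⟨rfl, not_le.1 (mt admits_one_iff.2 h)⟩
    · exact Or.inr (Or.inl ⟨rfl, (admits_two_or_mulEquiv G).resolve_left h⟩)
    · obtain _ | _ := subsingleton_or_nontrivial G
      · have hn5 : n ≤ 5 := Nat.lt_succ_iff.1 (not_le.1 (mt admits_of_six_le h))
        exact Or.inr (Or.inr ⟨⟨hn3, hn5⟩, mulEquiv_zmod_one⟩)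
      · exact absurd (admits_of_three_le hn3) h
  · rintro (⟨rfl, hG⟩ | ⟨rfl, ⟨⟨e⟩⟩ | ⟨⟨e⟩⟩ | ⟨⟨e⟩⟩ | ⟨⟨e⟩⟩ | ⟨⟨e⟩⟩⟩ | ⟨⟨hn3, hn5⟩, hG⟩)
    · exact mt admits_one_iff.1 (not_le.2 hG)
    · exact hasAffineSymmetries_zmod_one.not_admits_two e
    · exact hasAffineSymmetries_zmod_two.not_admits_two e
    · exact hasAffineSymmetries_zmod_three.not_admits_two e
    · exact hasAffineSymmetries_klein.not_admits_two e
    · exact hasAffineSymmetries_cube.not_admits_two e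
    · have := hsub hG
      exact not_admits_of_subsingleton (by omega) hn5
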